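/- Let $q$ be a power of $2$, let $m\ge 1$, let $V=\mathbb{F}_q^{2m}$ with its standard nondegenerate alternating form $(\cdot,\cdot)$, and let $G=\mathrm{Sp}_{2m}(q)$ be the isometry group of this form. Let $Q^+$ and $Q^-$ be quadratic forms on $V$ with $Q^{\pm}(x+y)-Q^{\pm}(x)-Q^{\pm}(y)=(x,y)$ for all $x,y\in V$, of Witt index $m$ and $m-1$ respectively, and for $\varepsilon\in\{+,-\}$ let $\mathrm{O}^{\varepsilon}_{2m}(q)\le G$ be the isometry group of $Q^{\varepsilon}$. Let $\pi$ be the complex permutation character of $G$ on $V$, let $\Omega^{\varepsilon}$ be the $G$-set of cosets of $\mathrm{O}^{\varepsilon}_{2m}(q)$ in $G$, and let $\pi^{\varepsilon}$ be its complex permutation character. Then: (1) The $\mathbb{C}G$-modules $\mathbb{C}V$ and $\mathbb{C}\Omega^+\oplus\mathbb{C}\Omega^-$ are isomorphic; that is, $\pi=\pi^++\pi^-$. (2) Suppose $m\ge 2$. Then the permutation character of $G$ on the set of $1$-dimensional subspaces of $V$ equals $1+\chi^++\chi^-$ for distinct nontrivial irreducible characters $\chi^+,\chi^-$ of $G$ with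 $\chi^-(1)<\chi^+(1)$, and the following holds for every $v\in V\setminus\{0\}$. Let $G_v$ be the stabilizer of $v$ and $P$ the stabilizer of $\langle v\rangle$ in $G$, and let $\mathcal{S}$ be any set of representatives, up to complex conjugation, of the nontrivial linear characters of $P$ with $G_v$ in their kernel (such sets exist). Then $|\mathcal{S}|=q/2-1$, the induced characters $\zeta_P^G$ $(\zeta\in\mathcal{S})$ are irreducible and pairwise distinct, and with $\pi'=\sum_{\zeta\in\mathcal{S}}\zeta_P^G$ we have $$\pi^+=1+\chi^++\pi',\qquad \pi^-=1+\chi^-+\pi'.$$ -/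

import Mathlib

open scoped LinearAlgebra.Projectivization

noncomputable section

namespace SpOrthogonal

/-- The symplectic group `Sp_{2m}(F)` of `2m × 2m` matrices preserving the standard form. -/
abbrev Sp (m : ℕ) (F : Type*) [Field F] : Type _ := ↥(Matrix.symplecticGroup (Fin m) F)

/-- The natural module `F^{2m}` (column vectors), on which `Sp m F` acts by `g • v = g *ᵥ v`. -/
abbrev V (m : ℕ) (F : Type*) : Type _ := Fin m ⊕ Fin m → F

/-- The standard symplectic form on the natural module, with Gram matrix `Matrix.J`. -/
def sympForm {m : ℕ} {F : Type*} [Field F] (x y : V m F) : F :=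
  x ⬝ᵥ Matrix.mulVec (Matrix.J (Fin m) F) y

/-- The quadratic form `Q` has the standard symplectic form as its associated bilinear form:
`Q (x + y) - Q x - Q y = (x, y)`. -/
def PolarizesToSymp {m : ℕ} {F : Type*} [Field F] (Q : QuadraticForm F (V m F)) : Prop :=
  ∀ x y : V m F, QuadraticMap.polar Q x y = sympForm x y

/-- The subspace `W` is totally singular for `Q`. -/
def IsTotallySingular {m : ℕ} {F : Type*} [Field F] (Q : QuadraticForm F (V m F))
    (W : Submodule F (V m F)) : Prop :=
  ∀ w ∈ W, Q w = 0

/-- `Q` is a quadratic form of plus type on the symplectic space `V`: it polarizes to the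
symplectic form and has Witt index `m`. -/
structure IsPlusType {m : ℕ} {F : Type*} [Field F] (Q : QuadraticForm F (V m F)) : Prop where
  polar_eq : PolarizesToSymp Q
  exists_singular : ∃ W, IsTotallySingular Q W ∧ Module.finrank F W = m
  finrank_le : ∀ W, IsTotallySingular Q W → Module.finrank F W ≤ m

/-- `Q` is a quadratic form of minus type on the symplectic space `V`: it polarizes to the
symplectic form and has Witt index `m - 1`. -/
structure IsMinusType {m : ℕ} {F : Type*} [Field F] (Q : QuadraticForm F (V m F)) : Prop where
  polar_eq : PolarizesToSymp Q
  exists_singular : ∃ W, IsTotallySingular Q W ∧ Module.finrank F W + 1 = m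
  finrank_lt : ∀ W, IsTotallySingular Q W → Module.finrank F W < m

/-- The orthogonal group of `Q` as a subgroup of `Sp_{2m}(F)`. For `Q` polarizing to the symplectic
form this is the full isometry group of `Q`, since isometries of `Q` preserve its polar form. -/
def orthogonalSubgroup {m : ℕ} {F : Type*} [Field F] (Q : QuadraticForm F (V m F)) :
    Subgroup (Sp m F) where
  carrier := {g | ∀ v : V m F, Q (g • v) = Q v}
  one_mem' := by intro v; rw [one_smul]
  mul_mem' := by
    intro a b ha hb v
    rw [mul_smul, ha, hb]
  inv_mem' := by
    intro a ha v
    rw [← ha (a⁻¹ • v), smul_inv_smul]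

/-- The complex permutation module `ℂX` of a `G`-set `X`. -/
abbrev permModule (G X : Type*) [Group G] [MulAction G X] :=
  Representation.ofMulAction ℂ G X

/-- The complex permutation character of a `G`-set `X`. -/
abbrev permChar (G X : Type*) [Group G] [MulAction G X] : G → ℂ :=
  (permModule G X).character

/-- `χ` is the character of an irreducible finite-dimensional complex representation of `G`. -/
def IsIrreducibleCharacter {G : Type*} [Group G] (χ : G → ℂ) : Prop :=
  ∃ (n : ℕ) (ρ : Representation ℂ G (Fin n → ℂ)), ρ.IsIrreducible ∧ ρ.character = χ

/-- The one-dimensional complex representation with character `ζ`. -/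
def linearRep {P : Type*} [Group P] (ζ : P →* ℂˣ) : Representation ℂ P ℂ :=
  (Algebra.lmul ℂ ℂ).toMonoidHom.comp ((Units.coeHom ℂ).comp ζ)

/-- The representation of `G` induced from the linear character `ζ` of the subgroup `P`. -/
abbrev inducedRep {G : Type*} [Group G] {P : Subgroup G} (ζ : P →* ℂˣ) :=
  Representation.ind P.subtype (linearRep ζ)

/-- The complex conjugate of a linear character. -/
def conjChar {P : Type*} [Group P] (ζ : P →* ℂˣ) : P →* ℂˣ :=
  (Units.map (starRingEnd ℂ).toMonoidHom).comp ζ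

/-- The parabolic subgroup `P`: the stabilizer in `Sp_{2m}(F)` of the `1`-subspace `⟨v⟩`. -/
abbrev parabolic {m : ℕ} {F : Type*} [Field F] (v : V m F) (hv : v ≠ 0) : Subgroup (Sp m F) :=
  MulAction.stabilizer (Sp m F) (Projectivization.mk F v hv)

/-- `ζ` is a nontrivial linear character of `P` with the vector stabilizer `G_v` in its kernel, that
is, a nontrivial member of `Irr(P / G_v)`. -/
def IsNontrivialModStabilizer {m : ℕ} {F : Type*} [Field F] {v : V m F} {hv : v ≠ 0}
    (ζ : parabolic v hv →* ℂˣ) : Prop :=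
  ζ ≠ 1 ∧ ∀ g : parabolic v hv, (g : Sp m F) • v = v → ζ g = 1

/-- `S` is a set of representatives, up to complex conjugation, of the nontrivial characters
in `Irr(P / G_v)`. -/
def IsConjRepresentatives {m : ℕ} {F : Type*} [Field F] {v : V m F} {hv : v ≠ 0}
    (S : Finset (parabolic v hv →* ℂˣ)) : Prop :=
  (∀ ζ ∈ S, IsNontrivialModStabilizer ζ) ∧
    ∀ ζ : parabolic v hv →* ℂˣ, IsNontrivialModStabilizer ζ →
      ∃! ξ, ξ ∈ S ∧ (ξ = ζ ∨ ξ = conjChar ζ)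

end SpOrthogonal

end

/-! Write q = |F|. The proof of (1) replaces the two coset spaces by the set of all quadratic forms
that polarize to the symplectic form. Two such forms differ by the square of a linear functional,
because squaring is bijective on F; hence there are as many forms as vectors. For a nontrivial
additive character ψ of F, the map Q ↦ ∑ ψ(Q(x)) x is equivariant, and it is injective because ψ∘(Q
− R) is a nontrivial character of V when Q ≠ R. So the permutation modules on forms and on vectors
are isomorphic (`formsEquivVectors`). Isomorphic modules have equally many orbits, at most two on
vectors; plus and minus forms lie in different orbits, so the set of forms is Ω⁺ ⊔ Ω⁻.

For (2), split the functions on V∖{0} by the action of the scalars: π = 1 + ∑ θ_η over the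
characters η of Fˣ, where θ_η is induced from the character of P obtained by composing η with the
eigenvalue on ⟨v⟩ (`character_inducedRep`). The orbits on pairs of nonzero vectors are classified by
the ratio or by the value of the form, and counting them gives ⟨θ_η, θ_ξ⟩ = [η = ξ] + [η = ξ = 1] +
[ηξ = 1] (`charInner_theta`). Since q − 1 is odd, η ≠ 1 implies η² ≠ 1; so θ_η is then irreducible
and equals θ_ξ only for ξ = η or ξ = η⁻¹, while θ_1, the character on points, has norm 3 and is 1 +
χ₁ + χ₂. Thus π = 2·1 + χ₁ + χ₂ + 2π'.

Each of π⁺, π⁻ contains 1, contains every θ_η with η ≠ 1 (the function Q ↦ η(√Q(v)) is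
semi-invariant under P), and contains χ₁ or χ₂, since an orthogonal group does not fuse singular and
nonsingular points. As χ₁ and χ₂ have multiplicity one in π, they are shared out one to each side,
and nothing else is left. The degrees are compared through |Ω⁺| > |Ω⁻|, which follows from a
positive Gauss sum (`card_cosets_lt`). -/

noncomputable section

namespace SpOrthogonal

/-! ### Ordinary characters and multisets of irreducible constituents -/

section CharacterTheory

open Representation

variable {G : Type*} [Group G]

lemma isIrreducible_of_equiv {V W : Type*} [AddCommGroup V] [Module ℂ V] [AddCommGroup W]
    [Module ℂ W] {ρ : Representation ℂ G V} {σ : Representation ℂ G W} (e : ρ.Equiv σ)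
    (h : ρ.IsIrreducible) : σ.IsIrreducible := by
  rw [irreducible_iff_isSimpleModule_asModule] at h ⊢
  exact (LinearEquiv.ofBijective (IntertwiningMap.equivLinearMapAsModule σ ρ
    e.symm.toIntertwiningMap) e.symm.toLinearEquiv.bijective).isSimpleModule_iff.2 h

lemma isIrreducibleCharacter_of_isIrreducible {V : Type*} [AddCommGroup V] [Module ℂ V]
    [FiniteDimensional ℂ V] {ρ : Representation ℂ G V} (h : ρ.IsIrreducible) :
    IsIrreducibleCharacter ρ.character := by
  let e : V ≃ₗ[ℂ] (Fin (Module.finrank ℂ V) → ℂ) := LinearEquiv.ofFinrankEq _ _ (by simp)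
  let σ : Representation ℂ G (Fin (Module.finrank ℂ V) → ℂ) :=
    (e.conjRingEquiv : Module.End ℂ V →* _).comp ρ
  let φ : ρ.Equiv σ := .mk e fun g ↦ by ext; simp [σ, LinearEquiv.conjRingEquiv]
  exact ⟨_, σ, isIrreducible_of_equiv φ h, (char_iso φ).symm⟩

lemma character_eq_add_of_isCompl {V : Type*} [AddCommGroup V] [Module ℂ V]
    [FiniteDimensional ℂ V] {ρ : Representation ℂ G V} {A B : Subrepresentation ρ}
    (h : IsCompl A.toSubmodule B.toSubmodule) :
    ρ.character = A.toRepresentation.character + B.toRepresentation.character := by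
  ext g
  have := LinearMap.trace_conj' (LinearMap.prodMap (A.toRepresentation g) (B.toRepresentation g))
    (Submodule.prodEquivOfIsCompl _ _ h)
  rw [LinearMap.trace_prodMap'] at this
  rw [Pi.add_apply, character, character, character, ← this]
  congr 1
  refine LinearMap.ext fun x ↦ ?_
  obtain ⟨⟨a, b⟩, rfl⟩ := (Submodule.prodEquivOfIsCompl _ _ h).surjective x
  simp [LinearEquiv.conj_apply, Subrepresentation.toRepresentation]

variable [Fintype G]

/-- The bilinear form `|G|⁻¹ ∑ a(g) b(g⁻¹)` on complex functions on `G`. -/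
def charInner (a b : G → ℂ) : ℂ := (Nat.card G : ℂ)⁻¹ * ∑ g, a g * b g⁻¹

lemma charInner_add_left (a b c : G → ℂ) : charInner (a + b) c = charInner a c + charInner b c := by
  simp [charInner, add_mul, Finset.sum_add_distrib, mul_add]

lemma charInner_add_right (a b c : G → ℂ) :
    charInner a (b + c) = charInner a b + charInner a c := by
  simp [charInner, mul_add, Finset.sum_add_distrib]

lemma charInner_zero_left (a : G → ℂ) : charInner 0 a = 0 := by simp [charInner]

lemma charInner_zero_right (a : G → ℂ) : charInner a 0 = 0 := by simp [charInner]

instance invertibleNatCardComplex : Invertible (Nat.card G : ℂ) :=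
  invertibleOfNonzero (Nat.cast_ne_zero.2 Nat.card_pos.ne')

lemma charInner_character {V W : Type*} [AddCommGroup V] [Module ℂ V] [FiniteDimensional ℂ V]
    [AddCommGroup W] [Module ℂ W] [FiniteDimensional ℂ W] (ρ : Representation ℂ G V)
    (σ : Representation ℂ G W) :
    charInner σ.character ρ.character = Module.finrank ℂ (IntertwiningMap ρ σ) :=
  card_inv_mul_sum_char_mul_char_eq_finrank ρ σ

open scoped Classical in
lemma charInner_irreducible {a b : G → ℂ} (ha : IsIrreducibleCharacter a)
    (hb : IsIrreducibleCharacter b) : charInner a b = if a = b then 1 else 0 := by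
  obtain ⟨n, ρ, hρ, rfl⟩ := ha
  obtain ⟨k, σ, hσ, rfl⟩ := hb
  have key := char_orthonormal ρ σ
  have self := char_orthonormal ρ ρ
  rw [if_pos ⟨.refl ρ⟩] at self
  split_ifs with h
  · rw [← h]; exact self
  · rw [if_neg fun ⟨e⟩ ↦ h (char_iso e).symm] at key
    exact key

open scoped Classical in
lemma charInner_multiset_sum_left {M : Multiset (G → ℂ)} (hM : ∀ a ∈ M, IsIrreducibleCharacter a)
    {b : G → ℂ} (hb : IsIrreducibleCharacter b) : charInner M.sum b = M.count b := by
  induction M using Multiset.induction_on with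
  | empty => simp [charInner_zero_left]
  | cons a M ih =>
    rw [Multiset.sum_cons, charInner_add_left, ih fun c hc ↦ hM c (Multiset.mem_cons_of_mem hc),
      charInner_irreducible (hM a (Multiset.mem_cons_self a M)) hb, Multiset.count_cons]
    split_ifs with h₁ h₂ h₂
    · push_cast; ring
    · exact absurd h₁.symm h₂
    · exact absurd h₂.symm h₁
    · simp

open scoped Classical in
lemma charInner_multiset_sum {M N : Multiset (G → ℂ)} (hM : ∀ a ∈ M, IsIrreducibleCharacter a)
    (hN : ∀ a ∈ N, IsIrreducibleCharacter a) :
    charInner M.sum N.sum = ((N.map fun b ↦ M.count b).sum : ℕ) := by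
  induction N using Multiset.induction_on with
  | empty => simp [charInner_zero_right]
  | cons a N ih =>
    rw [Multiset.sum_cons, charInner_add_right, ih fun c hc ↦ hN c (Multiset.mem_cons_of_mem hc),
      charInner_multiset_sum_left hM (hN a (Multiset.mem_cons_self a N))]
    simp

/-- The multiplicity of an irreducible character is recovered from the sum by pairing with it, so a
character determines its constituents. -/
lemma multiset_eq_of_sum_eq {M N : Multiset (G → ℂ)} (hM : ∀ a ∈ M, IsIrreducibleCharacter a)
    (hN : ∀ a ∈ N, IsIrreducibleCharacter a) (h : M.sum = N.sum) : M = N := by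
  classical
  ext a
  by_cases ha : IsIrreducibleCharacter a
  · have := charInner_multiset_sum_left hM ha
    rw [h, charInner_multiset_sum_left hN ha] at this
    exact_mod_cast this.symm
  · rw [Multiset.count_eq_zero_of_notMem fun h ↦ ha (hM a h),
      Multiset.count_eq_zero_of_notMem fun h ↦ ha (hN a h)]

/-- Maschke's theorem supplies the complement. The dimensions are recorded so that decomposition can
proceed by strong induction. -/
lemma exists_compl_subrepresentation {V : Type*} [AddCommGroup V] [Module ℂ V]
    [FiniteDimensional ℂ V] {ρ : Representation ℂ G V} (hV : 0 < Module.finrank ℂ V)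
    (h : ¬ ρ.IsIrreducible) : ∃ A B : Subrepresentation ρ,
      ρ.character = A.toRepresentation.character + B.toRepresentation.character ∧
      0 < Module.finrank ℂ A.toSubmodule ∧ 0 < Module.finrank ℂ B.toSubmodule ∧
      Module.finrank ℂ A.toSubmodule + Module.finrank ℂ B.toSubmodule = Module.finrank ℂ V := by
  have : NeZero (Nat.card G : ℂ) := ⟨Nat.cast_ne_zero.2 Nat.card_pos.ne'⟩
  have hnt : Nontrivial (Subrepresentation ρ) := by
    refine ⟨⊥, ⊤, fun hbt ↦ ?_⟩
    have : (⊥ : Submodule ℂ V) = ⊤ := congrArg Subrepresentation.toSubmodule hbt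
    rw [← finrank_top (R := ℂ), ← this, finrank_bot] at hV
    exact hV.false
  have : ∃ A : Subrepresentation ρ, A ≠ ⊥ ∧ A ≠ ⊤ := by
    by_contra! hall
    exact h ⟨fun A ↦ or_iff_not_imp_left.2 (hall A)⟩
  obtain ⟨A, hA⟩ := this
  obtain ⟨B, hAB⟩ := exists_isCompl A
  have hc : IsCompl A.toSubmodule B.toSubmodule := by
    refine IsCompl.of_eq ?_ ?_
    · exact congrArg Subrepresentation.toSubmodule hAB.inf_eq_bot
    · exact congrArg Subrepresentation.toSubmodule hAB.sup_eq_top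
  have hAb : A.toSubmodule ≠ ⊥ := fun h ↦ hA.1 (Subrepresentation.toSubmodule_injective h)
  have hAt : A.toSubmodule ≠ ⊤ := fun h ↦ hA.2 (Subrepresentation.toSubmodule_injective h)
  have hBb : B.toSubmodule ≠ ⊥ := fun h ↦ hAt (by simpa [h] using hc.sup_eq_top)
  exact ⟨A, B, character_eq_add_of_isCompl hc, by rwa [Module.finrank_pos_iff, Submodule.nontrivial_iff_ne_bot],
    by rwa [Module.finrank_pos_iff, Submodule.nontrivial_iff_ne_bot],
    Submodule.finrank_add_eq_of_isCompl hc⟩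

/-- Every character is a sum of irreducible characters. -/
lemma exists_multiset_irreducible {V : Type*} [AddCommGroup V] [Module ℂ V]
    [FiniteDimensional ℂ V] (ρ : Representation ℂ G V) : ∃ M : Multiset (G → ℂ),
      (∀ a ∈ M, IsIrreducibleCharacter a) ∧ M.sum = ρ.character := by
  induction hn : Module.finrank ℂ V using Nat.strong_induction_on generalizing V with
  | _ n ih =>
    rcases Nat.eq_zero_or_pos n with rfl | hpos
    · refine ⟨0, by simp, ?_⟩
      have : Subsingleton V := Module.finrank_zero_iff.1 hn
      ext g
      simp [character, Subsingleton.elim (ρ g) 0]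
    by_cases hirr : ρ.IsIrreducible
    · exact ⟨{ρ.character}, by simpa using isIrreducibleCharacter_of_isIrreducible hirr, by simp⟩
    obtain ⟨A, B, h, hA, hB, hAB⟩ := exists_compl_subrepresentation (hn ▸ hpos) hirr
    obtain ⟨M, hM, hMs⟩ := ih _ (by omega) A.toRepresentation rfl
    obtain ⟨N, hN, hNs⟩ := ih _ (by omega) B.toRepresentation rfl
    refine ⟨M + N, fun a ha ↦ (Multiset.mem_add.1 ha).elim (hM a) (hN a), ?_⟩
    rw [Multiset.sum_add, hMs, hNs, h]

/-- A representation whose character has norm one is irreducible. -/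
lemma isIrreducible_of_charInner_eq_one {V : Type*} [AddCommGroup V] [Module ℂ V]
    [FiniteDimensional ℂ V] {ρ : Representation ℂ G V}
    (h : charInner ρ.character ρ.character = 1) : ρ.IsIrreducible := by
  classical
  by_contra hirr
  have hpos : 0 < Module.finrank ℂ V := by
    by_contra h0
    have : Subsingleton V := (Module.finrank_zero_iff (R := ℂ)).1 (by omega)
    have h0 : ρ.character = 0 := by
      ext g
      simp [character, Subsingleton.elim (ρ g) 0]
    simp [h0, charInner_zero_left] at h
  obtain ⟨A, B, hAB, hA, hB, -⟩ := exists_compl_subrepresentation hpos hirr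
  have key {W : Type _} [AddCommGroup W] [Module ℂ W] [FiniteDimensional ℂ W]
      (σ : Representation ℂ G W) (hW : 0 < Module.finrank ℂ W) : ∃ M : Multiset (G → ℂ),
      (∀ a ∈ M, IsIrreducibleCharacter a) ∧ M.sum = σ.character ∧ 0 < M.card := by
    obtain ⟨M, hM, hMs⟩ := exists_multiset_irreducible σ
    refine ⟨M, hM, hMs, Multiset.card_pos.2 ?_⟩
    rintro rfl
    have := congrFun hMs 1
    rw [char_one] at this
    simp at this
    have : Module.finrank ℂ W = 0 := by exact_mod_cast this.symm
    omega
  obtain ⟨M, hM, hMs, hMc⟩ := key A.toRepresentation hA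
  obtain ⟨N, hN, hNs, hNc⟩ := key B.toRepresentation hB
  have hMN : ∀ a ∈ M + N, IsIrreducibleCharacter a :=
    fun a ha ↦ (Multiset.mem_add.1 ha).elim (hM a) (hN a)
  rw [hAB, ← hMs, ← hNs, ← Multiset.sum_add, charInner_multiset_sum hMN hMN] at h
  have h1 : ((M + N).map fun b ↦ (M + N).count b).sum = 1 := by exact_mod_cast h
  -- Every constituent contributes its multiplicity, at least 1, so the norm is at least the number
  -- of constituents, which here is at least two.
  have h2 : (M + N).card • 1 ≤ ((M + N).map fun b ↦ (M + N).count b).sum := by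
    rw [← Multiset.card_map (fun b ↦ (M + N).count b) (M + N)]
    refine Multiset.card_nsmul_le_sum fun x hx ↦ ?_
    obtain ⟨b, hb, rfl⟩ := Multiset.mem_map.1 hx
    exact Multiset.count_pos.2 hb
  rw [h1] at h2
  simp at h2
  omega

end CharacterTheory

/-! ### Permutation modules and orbit counting -/

section PermutationModules

open Representation MonoidAlgebra
open scoped Classical

variable {G : Type*} [Group G]

instance finiteDimensional_monoidAlgebra {X : Type*} [Finite X] :
    FiniteDimensional ℂ (MonoidAlgebra ℂ X) :=
  Module.Finite.equiv (coeffLinearEquiv ℂ : MonoidAlgebra ℂ X ≃ₗ[ℂ] X →₀ ℂ).symm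

lemma finrank_monoidAlgebra (X : Type*) [Finite X] :
    Module.finrank ℂ (MonoidAlgebra ℂ X) = Nat.card X := by
  have := Fintype.ofFinite X
  rw [LinearEquiv.finrank_eq (coeffLinearEquiv ℂ : MonoidAlgebra ℂ X ≃ₗ[ℂ] X →₀ ℂ),
    Module.finrank_finsupp_self, Nat.card_eq_fintype_card]

lemma trace_monoidAlgebra {X : Type*} [Fintype X]
    (f : MonoidAlgebra ℂ X →ₗ[ℂ] MonoidAlgebra ℂ X) :
    LinearMap.trace ℂ _ f = ∑ x, (f (single x 1)).coeff x := by
  let b : Module.Basis X ℂ (MonoidAlgebra ℂ X) := .ofRepr (coeffLinearEquiv ℂ)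
  rw [LinearMap.trace_eq_matrix_trace ℂ b, Matrix.trace]
  refine Finset.sum_congr rfl fun x _ ↦ ?_
  rw [Matrix.diag_apply, LinearMap.toMatrix_apply]
  rfl

lemma permChar_apply {X : Type*} [Fintype X] [MulAction G X] (g : G) :
    permChar G X g = ∑ x : X, if g • x = x then 1 else 0 := by
  rw [permChar, character, trace_monoidAlgebra]
  refine Finset.sum_congr rfl fun x _ ↦ ?_
  rw [ofMulAction_single, coeff_single, Finsupp.single_apply]

/-- Burnside's lemma twisted by a map `σ` which induces the map `τ` on orbits. -/
lemma sum_smul_eq_twist {X I : Type*} [Fintype G] [Fintype X] [Fintype I] [MulAction G X]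
    (f : X → I) (hf : Function.Surjective f) (hfib : ∀ x y, f x = f y ↔ ∃ g : G, g • x = y)
    (σ : X → X) (τ : I → I) (h : ∀ x, f (σ x) = τ (f x)) :
    ∑ g : G, ∑ x, (if g • x = σ x then 1 else 0 : ℂ) =
      Nat.card G * ∑ i, if τ i = i then 1 else 0 := by
  -- The set of g with g x = σ x is empty or a coset of the stabilizer of x, and it is nonempty
  -- exactly when `τ` fixes the orbit of x.
  have hstab (x : X) : ∑ g : G, (if g • x = σ x then 1 else 0 : ℂ) =
      if τ (f x) = f x then (Nat.card (MulAction.stabilizer G x) : ℂ) else 0 := by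
    split_ifs with hx
    · obtain ⟨k, hk⟩ := (hfib x (σ x)).1 (by rw [h, hx])
      rw [Finset.sum_boole, Nat.card_eq_fintype_card, ← Fintype.card_coe]
      congr 1
      refine Fintype.card_congr ⟨fun g ↦ ⟨k⁻¹ * g, ?_⟩, fun g ↦ ⟨k * g, ?_⟩, ?_, ?_⟩
      · have := g.2
        simp only [Finset.mem_filter, Finset.mem_univ, true_and] at this
        rw [MulAction.mem_stabilizer_iff, mul_smul, this, ← hk, inv_smul_smul]
      · simp only [Finset.mem_filter, Finset.mem_univ, true_and]
        rw [mul_smul, g.2, hk]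
      · intro g; simp
      · intro g; simp
    · refine Finset.sum_eq_zero fun g _ ↦ if_neg fun hg ↦ hx ?_
      rw [← h]
      exact ((hfib x (σ x)).2 ⟨g, hg⟩).symm
  rw [Finset.sum_comm, Finset.sum_congr rfl fun x _ ↦ hstab x, Finset.mul_sum,
    ← Finset.sum_fiberwise (s := Finset.univ) (g := f)]
  refine Finset.sum_congr rfl fun i _ ↦ ?_
  rw [Finset.sum_congr rfl (g := fun x ↦ if τ i = i then
    (Nat.card (MulAction.stabilizer G x) : ℂ) else 0)
    fun x hx ↦ by rw [(Finset.mem_filter.1 hx).2]]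
  split_ifs with hi
  · obtain ⟨x₀, rfl⟩ := hf i
    -- The fibres of `f` are the orbits, so by orbit–stabilizer each fibre with `τ i = i`
    -- contributes |G| in total.
    have hcard (x : X) (hx : f x = f x₀) :
        (Finset.univ.filter fun x ↦ f x = f x₀).card * Nat.card (MulAction.stabilizer G x) =
          Nat.card G := by
      rw [Nat.card_eq_fintype_card, Nat.card_eq_fintype_card,
        ← MulAction.card_orbit_mul_card_stabilizer_eq_card_group G x, ← Fintype.card_coe]
      congr 1
      refine Fintype.card_congr (Equiv.subtypeEquivRight fun y ↦ ?_)
      rw [Finset.mem_filter, MulAction.mem_orbit_iff, ← hfib x y, hx]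
      simp [eq_comm]
    have hne : ((Finset.univ.filter fun x ↦ f x = f x₀).card : ℂ) ≠ 0 := by
      rw [Nat.cast_ne_zero]
      exact (Finset.card_pos.2 ⟨x₀, by simp⟩).ne'
    rw [Finset.sum_congr rfl (g := fun x ↦ (Nat.card G : ℂ) *
      ((Finset.univ.filter fun x ↦ f x = f x₀).card : ℂ)⁻¹)]
    · rw [Finset.sum_const, nsmul_eq_mul]
      field_simp
    · intro x hx
      rw [← hcard x (Finset.mem_filter.1 hx).2]
      push_cast
      field_simp
  · simp

/-- Burnside's lemma on X × Y, with no twist; the inverse in `charInner` is harmless because g and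
g⁻¹ have the same fixed points. -/
lemma charInner_permChar {X Y : Type*} [Fintype G] [Finite X] [Finite Y] [MulAction G X]
    [MulAction G Y] : charInner (permChar G X) (permChar G Y) =
      Nat.card (MulAction.orbitRel.Quotient G (X × Y)) := by
  have := Fintype.ofFinite X
  have := Fintype.ofFinite Y
  have key := sum_smul_eq_twist (G := G) (X := X × Y)
    (fun x ↦ (Quotient.mk _ x : MulAction.orbitRel.Quotient G (X × Y))) Quotient.mk_surjective
    (fun x y ↦ by
      rw [eq_comm, Quotient.eq, MulAction.orbitRel_apply, MulAction.mem_orbit_iff]) id id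
    fun _ ↦ rfl
  unfold charInner
  rw [inv_mul_eq_iff_eq_mul₀ (Nat.cast_ne_zero.2 Nat.card_pos.ne')]
  simp only [id_eq, if_true, Finset.sum_const, Finset.card_univ, nsmul_eq_mul, mul_one] at key
  rw [Nat.card_eq_fintype_card (α := MulAction.orbitRel.Quotient G (X × Y)), ← key]
  refine Finset.sum_congr rfl fun g _ ↦ ?_
  rw [permChar_apply, permChar_apply, Finset.sum_mul_sum, Fintype.sum_prod_type]
  refine Finset.sum_congr rfl fun x _ ↦ Finset.sum_congr rfl fun y _ ↦ ?_
  simp only [inv_smul_eq_iff, Prod.smul_mk, Prod.mk_inj, eq_comm (a := y), ite_and]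
  split_ifs <;> simp

lemma charInner_permChar_one {X : Type*} [Fintype G] [Finite X] [MulAction G X] :
    charInner (permChar G X) 1 = Nat.card (MulAction.orbitRel.Quotient G X) := by
  have := Fintype.ofFinite X
  have key := sum_smul_eq_twist (G := G) (X := X)
    (fun x ↦ (Quotient.mk _ x : MulAction.orbitRel.Quotient G X)) Quotient.mk_surjective
    (fun x y ↦ by
      rw [eq_comm, Quotient.eq, MulAction.orbitRel_apply, MulAction.mem_orbit_iff]) id id
    fun _ ↦ rfl
  unfold charInner
  rw [inv_mul_eq_iff_eq_mul₀ (Nat.cast_ne_zero.2 Nat.card_pos.ne')]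
  simp only [id_eq, if_true, Finset.sum_const, Finset.card_univ, nsmul_eq_mul, mul_one] at key
  rw [Nat.card_eq_fintype_card (α := MulAction.orbitRel.Quotient G X), ← key]
  simp [permChar_apply]

/-- The permutation module of a disjoint union of two invariant parts. -/
def permModuleProd {X Y Z : Type*} [MulAction G X] [MulAction G Y] [MulAction G Z] (e : X ⊕ Y ≃ Z)
    (hl : ∀ (g : G) x, e (.inl (g • x)) = g • e (.inl x))
    (hr : ∀ (g : G) y, e (.inr (g • y)) = g • e (.inr y)) :
    (permModule G Z).Equiv ((permModule G X).prod (permModule G Y)) :=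
  .symm <| .mk (((coeffLinearEquiv ℂ).prodCongr (coeffLinearEquiv ℂ)).trans <|
    (Finsupp.sumFinsuppLEquivProdFinsupp ℂ).symm.trans <|
      (Finsupp.domLCongr e).trans (coeffLinearEquiv ℂ).symm) fun g ↦ by
    refine LinearMap.prod_ext ?_ ?_ <;> ext x
    · simp [hl]
    · simp [hr]

lemma character_prod {V W : Type*} [AddCommGroup V] [Module ℂ V] [FiniteDimensional ℂ V]
    [AddCommGroup W] [Module ℂ W] [FiniteDimensional ℂ W] (ρ : Representation ℂ G V)
    (σ : Representation ℂ G W) : (ρ.prod σ).character = ρ.character + σ.character := by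
  ext g
  exact LinearMap.trace_prodMap' (ρ g) (σ g)

end PermutationModules

/-! ### Representations induced from linear characters -/

section Induced

open Representation

variable {G : Type*} [Group G] {P : Subgroup G} (ζ : P →* ℂˣ)

/-- The generator `h ⊗ 1` of the induced module. -/
def indMk (h : G) : IndV P.subtype (linearRep ζ) := IndV.mk P.subtype (linearRep ζ) h 1

/-- The induced module is a space of coinvariants, so p acts trivially on tensors: moving p out of
the group factor costs ζ(p)⁻¹. -/
lemma indMk_mul (p : P) (h : G) : indMk ζ (p * h) = (ζ p : ℂ)⁻¹ • indMk ζ h := by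
  have := Coinvariants.mk_self_apply (Representation.tprod ((leftRegular ℂ G).comp P.subtype)
    (linearRep ζ)) p (TensorProduct.tmul ℂ (MonoidAlgebra.single h 1) 1)
  rw [eq_inv_smul_iff₀ (ζ p).ne_zero]
  refine Eq.trans ?_ this
  rw [indMk, ← map_smul]
  simp [linearRep]
  rfl

instance [Finite G] : FiniteDimensional ℂ (IndV P.subtype (linearRep ζ)) := by
  have : FiniteDimensional ℂ (TensorProduct ℂ (MonoidAlgebra ℂ G) ℂ) := inferInstance
  exact Module.Finite.quotient _ _

lemma ind_linearMap_ext {W : Type*} [AddCommGroup W] [Module ℂ W]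
    {f f' : IndV P.subtype (linearRep ζ) →ₗ[ℂ] W} (h : ∀ g, f (indMk ζ g) = f' (indMk ζ g)) :
    f = f' :=
  IndV.hom_ext _ _ fun g ↦ LinearMap.ext_ring (h g)

variable {ζ} in
/-- Frobenius reciprocity: semi-invariant vectors give maps from the induced module. -/
def indLift {W : Type*} [AddCommGroup W] [Module ℂ W] {ρ : Representation ℂ G W} {y : W}
    (hy : ∀ p : P, ρ p y = (ζ p : ℂ) • y) : IntertwiningMap (inducedRep ζ) ρ where
  toLinearMap := Coinvariants.lift _ (TensorProduct.lift <|
    (Finsupp.lift _ _ _ fun h ↦ LinearMap.toSpanSingleton ℂ W (ρ h⁻¹ y)) ∘ₗ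
      (MonoidAlgebra.coeffLinearEquiv ℂ).toLinearMap) fun p ↦ by
    ext h
    have hp : ρ (p : G)⁻¹ y = (ζ p : ℂ)⁻¹ • y := by
      rw [eq_inv_smul_iff₀ (ζ p).ne_zero, ← map_smul, ← hy, inv_self_apply]
    simp [linearRep, hp]
  isIntertwining' g := by
    refine ind_linearMap_ext _ fun h ↦ ?_
    simp [indMk]

variable {ζ} in
lemma indLift_indMk {W : Type*} [AddCommGroup W] [Module ℂ W] {ρ : Representation ℂ G W} {y : W}
    (hy : ∀ p : P, ρ p y = (ζ p : ℂ) • y) (h : G) : indLift hy (indMk ζ h) = ρ h⁻¹ y := by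
  simp [indLift, indMk]

end Induced

/-! ### The symplectic form, transvections and Witt's theorem for pairs -/

section Symplectic

variable {m : ℕ} {F : Type*} [Field F]

/-- The symplectic form as a bilinear form. -/
def sympBilin (m : ℕ) (F : Type*) [Field F] : LinearMap.BilinForm F (V m F) :=
  Matrix.toBilin' (Matrix.J (Fin m) F)

lemma sympForm_eq_sympBilin (x y : V m F) : sympForm x y = sympBilin m F x y :=
  (Matrix.toBilin'_apply' _ _ _).symm

lemma sympForm_add_left (x y z : V m F) : sympForm (x + y) z = sympForm x z + sympForm y z := by
  simp [sympForm_eq_sympBilin]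

lemma sympForm_add_right (x y z : V m F) : sympForm x (y + z) = sympForm x y + sympForm x z := by
  simp [sympForm_eq_sympBilin]

lemma sympForm_smul_left (a : F) (x y : V m F) : sympForm (a • x) y = a * sympForm x y := by
  simp [sympForm_eq_sympBilin]

lemma sympForm_smul_right (a : F) (x y : V m F) : sympForm x (a • y) = a * sympForm x y := by
  simp [sympForm_eq_sympBilin]

lemma sympForm_zero_right (x : V m F) : sympForm x 0 = 0 := by
  simp [sympForm_eq_sympBilin]

lemma sympForm_apply (x y : V m F) :
    sympForm x y = ∑ i, (x (.inr i) * y (.inl i) - x (.inl i) * y (.inr i)) := by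
  simp [sympForm, Matrix.J, dotProduct, Matrix.fromBlocks_mulVec, Finset.sum_sub_distrib,
    Matrix.neg_mulVec]
  ring

lemma sympForm_self (x : V m F) : sympForm x x = 0 := by
  rw [sympForm_apply]
  exact Finset.sum_eq_zero fun i _ ↦ by ring

lemma sympForm_neg_comm (x y : V m F) : sympForm x y = - sympForm y x := by
  rw [sympForm_apply, sympForm_apply, ← Finset.sum_neg_distrib]
  exact Finset.sum_congr rfl fun i _ ↦ by ring

lemma sympBilin_nondegenerate : (sympBilin m F).Nondegenerate :=
  LinearMap.BilinForm.nondegenerate_toBilin'_of_det_ne_zero' _ (Matrix.isUnit_det_J _ _).ne_zero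

/-- Every linear functional is represented by the symplectic form. -/
lemma exists_sympForm_eq (f : V m F →ₗ[F] F) : ∃ z, ∀ x, sympForm x z = f x := by
  obtain ⟨z, hz⟩ := ((sympBilin m F).toDual sympBilin_nondegenerate).surjective (-f)
  refine ⟨z, fun x ↦ ?_⟩
  rw [sympForm_neg_comm, sympForm_eq_sympBilin,
    ← LinearMap.BilinForm.toDual_def sympBilin_nondegenerate, hz]
  simp

lemma eq_of_forall_sympForm_eq {y z : V m F} (h : ∀ x, sympForm x y = sympForm x z) : y = z := by
  refine ((sympBilin m F).toDual sympBilin_nondegenerate).injective (LinearMap.ext fun x ↦ ?_)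
  rw [LinearMap.BilinForm.toDual_def, LinearMap.BilinForm.toDual_def, ← sympForm_eq_sympBilin,
    ← sympForm_eq_sympBilin, sympForm_neg_comm, h, ← sympForm_neg_comm]

lemma exists_sympForm_ne_zero {x : V m F} (hx : x ≠ 0) : ∃ y, sympForm x y ≠ 0 := by
  by_contra! h
  refine hx (eq_of_forall_sympForm_eq fun y ↦ ?_)
  rw [sympForm_neg_comm, h, sympForm_zero_right, neg_zero]

/-- Linearly independent vectors can be paired to arbitrary values. -/
lemma exists_sympForm_eq_of_linearIndependent {n : ℕ} {b : Fin n → V m F}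
    (hb : LinearIndependent F b) (c : Fin n → F) : ∃ z, ∀ i, sympForm (b i) z = c i := by
  obtain ⟨f, hf⟩ := LinearMap.exists_extend ((Module.Basis.span hb).constr F c)
  obtain ⟨z, hz⟩ := exists_sympForm_eq f
  refine ⟨z, fun i ↦ ?_⟩
  have := LinearMap.congr_fun hf (Module.Basis.span hb i)
  rw [Module.Basis.constr_basis, LinearMap.comp_apply, Submodule.subtype_apply,
    Module.Basis.span_apply] at this
  rw [hz, this]

lemma smul_def' (g : Sp m F) (x : V m F) : g • x = (g : Matrix _ _ F).mulVec x := rfl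

lemma sympForm_smul_smul (g : Sp m F) (x y : V m F) : sympForm (g • x) (g • y) = sympForm x y := by
  have h := SymplecticGroup.mem_iff'.1 g.2
  rw [smul_def', smul_def', sympForm, Matrix.mulVec_mulVec, Matrix.dotProduct_mulVec,
    Matrix.vecMul_mulVec, ← Matrix.dotProduct_mulVec, ← Matrix.mul_assoc, h, sympForm]

/-- A linear map preserving the symplectic form, as an element of the symplectic group. -/
def Sp.ofLinearMap (f : V m F →ₗ[F] V m F) (hf : ∀ x y, sympForm (f x) (f y) = sympForm x y) :
    Sp m F :=
  ⟨LinearMap.toMatrix' f, by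
    rw [SymplecticGroup.mem_iff']
    refine Matrix.toBilin'.injective (LinearMap.ext₂ fun x y ↦ ?_)
    rw [Matrix.toBilin'_apply', Matrix.toBilin'_apply']
    have := hf x y
    rw [sympForm, sympForm, ← LinearMap.toMatrix'_mulVec f x, ← LinearMap.toMatrix'_mulVec f y,
      Matrix.mulVec_mulVec, Matrix.dotProduct_mulVec, Matrix.vecMul_mulVec, ← Matrix.dotProduct_mulVec, ← Matrix.mul_assoc] at this
    exact this⟩

lemma Sp.ofLinearMap_smul (f : V m F →ₗ[F] V m F)
    (hf : ∀ x y, sympForm (f x) (f y) = sympForm x y) (x : V m F) :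
    Sp.ofLinearMap f hf • x = f x :=
  LinearMap.toMatrix'_mulVec f x

/-- The symplectic transvection `x ↦ x + t (x, u) u`. -/
def transvection (t : F) (u : V m F) : Sp m F :=
  Sp.ofLinearMap (LinearMap.id + t • (LinearMap.flip (sympBilin m F) u).smulRight u) fun x y ↦ by
    simp only [LinearMap.add_apply, LinearMap.id_apply, LinearMap.smul_apply,
      LinearMap.smulRight_apply, LinearMap.flip_apply, ← sympForm_eq_sympBilin, sympForm_add_left,
      sympForm_add_right, sympForm_smul_left, sympForm_smul_right, sympForm_self]
    rw [sympForm_neg_comm u y]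
    ring

lemma transvection_smul (t : F) (u x : V m F) :
    transvection t u • x = x + (t * sympForm x u) • u := by
  rw [transvection, Sp.ofLinearMap_smul]
  simp [sympForm_eq_sympBilin, mul_smul]

/-- Two vectors which are not orthogonal are related by a transvection. -/
lemma transvection_smul_eq {x y : V m F} (h : sympForm x y ≠ 0) :
    transvection (sympForm x y)⁻¹ (y - x) • x = y := by
  rw [transvection_smul, sub_eq_add_neg, sympForm_add_right, ← neg_one_smul F x,
    sympForm_smul_right, sympForm_self, mul_zero, add_zero, inv_mul_cancel₀ h]
  simp

/-- A transvection fixes the vectors which pair equally with its two end points. -/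
lemma transvection_smul_eq_self {v x y : V m F} (t : F) (h : sympForm v x = sympForm v y) :
    transvection t (y - x) • v = v := by
  rw [transvection_smul, sub_eq_add_neg, sympForm_add_right, ← neg_one_smul F x,
    sympForm_smul_right, h]
  simp

lemma exists_smul_eq {x y : V m F} (hx : x ≠ 0) (hy : y ≠ 0) : ∃ g : Sp m F, g • x = y := by
  have key {x y : V m F} (hxy : sympForm x y ≠ 0) : ∃ g : Sp m F, g • x = y :=
    ⟨_, transvection_smul_eq hxy⟩
  -- V is not the union of the two hyperplanes orthogonal to x and to y. A vector z outside both
  -- allows two transvections, from x to z and from z to y.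
  have : ∃ z, sympForm x z ≠ 0 ∧ sympForm y z ≠ 0 := by
    obtain ⟨a, ha⟩ := exists_sympForm_ne_zero hx
    obtain ⟨b, hb⟩ := exists_sympForm_ne_zero hy
    by_cases ha' : sympForm y a = 0
    · by_cases hb' : sympForm x b = 0
      · exact ⟨a + b, by rwa [sympForm_add_right, hb', add_zero],
          by rwa [sympForm_add_right, ha', zero_add]⟩
      · exact ⟨b, hb', hb⟩
    · exact ⟨a, ha, ha'⟩
  obtain ⟨z, hxz, hyz⟩ := this
  obtain ⟨g, hg⟩ := key hxz
  obtain ⟨k, hk⟩ := key hyz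
  exact ⟨k⁻¹ * g, by rw [mul_smul, hg, ← hk, inv_smul_smul]⟩

/-- The stabilizer of `v` is transitive on the vectors outside `⟨v⟩` with a given value of
`(v, ·)`. -/
lemma exists_smul_eq_of_stabilizer {v x y : V m F} (hx : LinearIndependent F ![v, x])
    (hy : LinearIndependent F ![v, y]) (h : sympForm v x = sympForm v y) :
    ∃ g : Sp m F, g • v = v ∧ g • x = y := by
  have key {x y : V m F} (hxy : sympForm x y ≠ 0) (h : sympForm v x = sympForm v y) :
      ∃ g : Sp m F, g • v = v ∧ g • x = y :=
    ⟨_, transvection_smul_eq_self _ h, transvection_smul_eq hxy⟩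
  by_cases hxy : sympForm x y = 0
  swap
  · exact key hxy h
  by_cases heq : x = y
  · exact ⟨1, by simp, by simpa⟩
  -- If x and y are orthogonal, one passes through z. The condition that z pairs with v as x does
  -- makes both transvections fix v.
  have : ∃ z, sympForm v z = sympForm v x ∧ sympForm x z ≠ 0 ∧ sympForm y z ≠ 0 := by
    by_cases hli : LinearIndependent F ![v, x, y]
    · obtain ⟨z, hz⟩ := exists_sympForm_eq_of_linearIndependent hli ![sympForm v x, 1, 1]
      exact ⟨z, hz 0, (hz 1).trans_ne one_ne_zero, (hz 2).trans_ne one_ne_zero⟩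
    · have hspan : y ∈ Submodule.span F {v, x} := by
        by_contra hn
        refine hli ?_
        have := (linearIndependent_finSnoc (v := ![v, x]) (x := y)).2 ⟨hx, by simpa [Set.pair_comm] using hn⟩
        have hv : ![v, x, y] = Fin.snoc (α := fun _ ↦ V m F) ![v, x] y := by
          ext i
          fin_cases i <;> rfl
        rwa [hv]
      obtain ⟨a, b, rfl⟩ := Submodule.mem_span_pair.1 hspan
      -- Here y = a v + b x. If (v, x) ≠ 0, then (v, x) = (v, y) forces b = 1, and (x, y) = 0 forces
      -- a = 0, so that y = x.
      have hvx : sympForm v x = 0 := by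
        by_contra hvx
        rw [sympForm_add_right, sympForm_smul_right, sympForm_smul_right, sympForm_self, mul_zero,
          zero_add] at h
        have hb : b = 1 := by
          field_simp at h
          exact h.symm
        rw [sympForm_add_right, sympForm_smul_right, sympForm_smul_right, sympForm_self, mul_zero,
          add_zero, sympForm_neg_comm] at hxy
        have ha : a = 0 := by simpa [hvx] using hxy
        exact heq (by simp [ha, hb])
      have hb : b ≠ 0 := by
        rintro rfl
        rw [LinearIndependent.pair_iff] at hy
        simpa using hy a (-1) (by simp)
      obtain ⟨z, hz⟩ := exists_sympForm_eq_of_linearIndependent hx ![0, 1]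
      have h0 : sympForm v z = 0 := hz 0
      have h1 : sympForm x z = 1 := hz 1
      refine ⟨z, by rw [h0, hvx], by simp [h1], ?_⟩
      rw [sympForm_add_left, sympForm_smul_left, sympForm_smul_left, h0, h1]
      simpa
  obtain ⟨z, hvz, hxz, hyz⟩ := this
  obtain ⟨g, hgv, hg⟩ := key hxz hvz.symm
  obtain ⟨k, hkv, hk⟩ := key hyz (h.symm.trans hvz.symm)
  refine ⟨k⁻¹ * g, ?_, by rw [mul_smul, hg, ← hk, inv_smul_smul]⟩
  rw [mul_smul, hgv, inv_smul_eq_iff, hkv]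

/-- The orbits of the symplectic group on pairs of independent vectors. -/
lemma exists_smul_pair_eq {x y x' y' : V m F} (h : LinearIndependent F ![x, y])
    (h' : LinearIndependent F ![x', y']) (hxy : sympForm x y = sympForm x' y') :
    ∃ g : Sp m F, g • x = x' ∧ g • y = y' := by
  obtain ⟨g, hg⟩ := exists_smul_eq (h.ne_zero 0) (h'.ne_zero 0)
  simp only [Matrix.cons_val_zero] at hg
  have hgy : LinearIndependent F ![x', g • y] := by
    rw [LinearIndependent.pair_iff] at h ⊢
    intro s t hst
    refine h s t ?_
    rw [← hg, ← smul_comm g, ← smul_comm g, ← smul_add, smul_eq_zero_iff_eq] at hst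
    exact hst
  obtain ⟨k, hk, hky⟩ := exists_smul_eq_of_stabilizer hgy h'
    (by rw [← hxy, ← hg, sympForm_smul_smul])
  exact ⟨k * g, by rw [mul_smul, hg, hk], by rw [mul_smul, hky]⟩

end Symplectic

/-! ### Quadratic forms polarizing to the symplectic form -/

section Forms

open Representation MonoidAlgebra

variable {m : ℕ} {F : Type*} [Field F]

/-- The quadratic forms polarizing to the standard symplectic form. -/
abbrev Forms (m : ℕ) (F : Type*) [Field F] : Type _ :=
  {Q : QuadraticForm F (V m F) // PolarizesToSymp Q}

lemma Forms.map_add (Q : Forms m F) (x y : V m F) :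
    Q.1 (x + y) = Q.1 x + Q.1 y + sympForm x y := by
  rw [← Q.2 x y, QuadraticMap.polar]
  ring

instance : MulAction (Sp m F) (Forms m F) where
  smul g Q := ⟨Q.1.comp (DistribSMul.toLinearMap F (V m F) g⁻¹), fun x y ↦ by
    have := Q.2 (g⁻¹ • x) (g⁻¹ • y)
    rw [sympForm_smul_smul] at this
    rw [← this]
    simp [QuadraticMap.polar]⟩
  one_smul Q := by
    refine Subtype.ext (QuadraticMap.ext fun x ↦ ?_)
    change Q.1 ((1 : Sp m F)⁻¹ • x) = Q.1 x
    simp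
  mul_smul g h Q := by
    refine Subtype.ext (QuadraticMap.ext fun x ↦ ?_)
    change Q.1 ((g * h)⁻¹ • x) = Q.1 (h⁻¹ • g⁻¹ • x)
    rw [mul_inv_rev, mul_smul]

lemma Forms.smul_apply (g : Sp m F) (Q : Forms m F) (x : V m F) : (g • Q).1 x = Q.1 (g⁻¹ • x) :=
  rfl

lemma Forms.ext {Q Q' : Forms m F} (h : ∀ x, Q.1 x = Q'.1 x) : Q = Q' :=
  Subtype.ext (QuadraticMap.ext h)

lemma Forms.mem_orthogonalSubgroup_iff (Q : Forms m F) (g : Sp m F) :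
    g ∈ orthogonalSubgroup Q.1 ↔ g • Q = Q := by
  constructor
  · intro h
    refine Forms.ext fun x ↦ ?_
    rw [smul_apply, ← h (g⁻¹ • x), smul_inv_smul]
  · intro h x
    conv_lhs => rw [← h]
    rw [smul_apply, inv_smul_smul]

/-- The map from cosets of the orthogonal group to quadratic forms. -/
def Forms.ofCoset (Q : Forms m F) (c : Sp m F ⧸ orthogonalSubgroup Q.1) : Forms m F :=
  Quotient.liftOn' c (fun g ↦ g • Q) fun a b h ↦ by
    rw [QuotientGroup.leftRel_apply, mem_orthogonalSubgroup_iff, mul_smul, inv_smul_eq_iff] at h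
    exact h.symm

lemma Forms.ofCoset_smul (Q : Forms m F) (g : Sp m F) (c : Sp m F ⧸ orthogonalSubgroup Q.1) :
    Q.ofCoset (g • c) = g • Q.ofCoset c := by
  induction c using QuotientGroup.induction_on with
  | H k => exact mul_smul g k Q

lemma Forms.ofCoset_injective (Q : Forms m F) : Function.Injective Q.ofCoset := by
  intro a b
  induction a using QuotientGroup.induction_on
  induction b using QuotientGroup.induction_on
  intro h
  rw [QuotientGroup.eq, mem_orthogonalSubgroup_iff, mul_smul, inv_smul_eq_iff]
  exact h.symm

lemma Forms.range_ofCoset (Q : Forms m F) : Set.range Q.ofCoset = MulAction.orbit (Sp m F) Q := by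
  ext R
  constructor
  · rintro ⟨c, rfl⟩
    induction c using QuotientGroup.induction_on with
    | H k => exact ⟨k, rfl⟩
  · rintro ⟨g, rfl⟩
    exact ⟨(g : Sp m F ⧸ _), rfl⟩

/-- Forms in the same orbit have totally singular subspaces of the same dimensions. -/
lemma Forms.notMem_orbit_of_type {Qp Qm : Forms m F} (hp : IsPlusType Qp.1)
    (hm : IsMinusType Qm.1) : Qm ∉ MulAction.orbit (Sp m F) Qp := by
  rintro ⟨g, rfl⟩
  obtain ⟨W, hW, hWm⟩ := hp.exists_singular
  let e : V m F ≃ₗ[F] V m F := DistribMulAction.toLinearEquiv F (V m F) g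
  have := hm.finrank_lt (W.map e.toLinearMap) (by
    rintro _ ⟨w, hw, rfl⟩
    change Qp.1 (g⁻¹ • g • w) = 0
    rw [inv_smul_smul, hW w hw])
  rw [LinearEquiv.finrank_map_eq] at this
  omega

/-- A nontrivial additive character of the field. -/
def addCharF (F : Type*) [Field F] [Fintype F] : AddChar F ℂ :=
  AddChar.FiniteField.primitiveChar_to_Complex F

lemma addCharF_ne_one [Fintype F] : addCharF F ≠ 1 := by
  have := AddChar.FiniteField.primitiveChar_to_Complex_isPrimitive (F := F) one_ne_zero
  rwa [AddChar.mulShift_one] at this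

/-- The nonzero vectors form at most one orbit, so an orbit is determined by the truth value of its
being the orbit of 0. -/
lemma card_orbits_vectors_le :
    Nat.card (MulAction.orbitRel.Quotient (Sp m F) (V m F)) ≤ 2 := by
  have : Function.Injective (fun c : MulAction.orbitRel.Quotient (Sp m F) (V m F) ↦
      (c = Quotient.mk'' 0 : Prop)) := by
    intro a b
    induction a using Quotient.inductionOn' with | _ x
    induction b using Quotient.inductionOn' with | _ y
    simp only [Quotient.eq'', MulAction.orbitRel_apply, MulAction.mem_orbit_iff, smul_zero,
      exists_const, eq_iff_iff]
    intro h
    by_cases hx : x = 0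
    · exact ⟨1, by simp [← h.1 hx.symm, hx]⟩
    · exact exists_smul_eq (fun hy ↦ hx (h.2 hy.symm).symm) hx
  simpa using Nat.card_le_card_of_injective _ this

section CharTwo

variable [CharP F 2]

/-- The form `Q + (·, b)²`. -/
def Forms.addSq (Q : Forms m F) (b : V m F) : Forms m F :=
  ⟨Q.1 + QuadraticMap.linMulLin (LinearMap.flip (sympBilin m F) b)
      (LinearMap.flip (sympBilin m F) b), fun x y ↦ by
    have h2 : (2 : F) = 0 := CharTwo.two_eq_zero
    rw [← Q.2 x y]
    simp only [QuadraticMap.polar, add_apply, QuadraticMap.linMulLin_apply,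
      _root_.map_add]
    linear_combination
      (LinearMap.flip (sympBilin m F) b x * LinearMap.flip (sympBilin m F) b y) * h2⟩

lemma Forms.addSq_apply (Q : Forms m F) (b x : V m F) :
    (Q.addSq b).1 x = Q.1 x + sympForm x b ^ 2 := by
  simp [addSq, sympForm_eq_sympBilin, sq]

lemma sympForm_comm (x y : V m F) : sympForm x y = sympForm y x := by
  rw [sympForm_neg_comm, CharTwo.neg_eq]

variable [Fintype F]

/-- The square root in a finite field of characteristic two. -/
def sqrtF (F : Type*) [Field F] [Fintype F] [CharP F 2] : F ≃+* F := (frobeniusEquiv F 2).symm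

lemma sqrtF_sq (x : F) : sqrtF F x ^ 2 = x :=
  (frobeniusEquiv F 2).apply_symm_apply x

lemma sqrtF_pow_two (x : F) : sqrtF F (x ^ 2) = x :=
  (frobeniusEquiv F 2).symm_apply_apply x

/-- The difference R − Q of two forms is additive, because the polar forms cancel, and scales by
squares. Its square root is therefore linear, hence of the form (·, b) by nondegeneracy. -/
lemma Forms.addSq_bijective (Q : Forms m F) : Function.Bijective Q.addSq := by
  constructor
  · intro b c h
    refine eq_of_forall_sympForm_eq fun x ↦ ?_
    have := congrArg (fun R : Forms m F ↦ R.1 x) h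
    simp only [addSq_apply, add_right_inj] at this
    rw [← sqrtF_pow_two (sympForm x b), this, sqrtF_pow_two]
  · intro R
    let f : V m F →ₗ[F] F :=
      { toFun := fun x ↦ sqrtF F (R.1 x - Q.1 x)
        map_add' := fun x y ↦ by
          rw [← _root_.map_add, R.map_add, Q.map_add]
          congr 1
          ring
        map_smul' := fun a x ↦ by
          rw [QuadraticMap.map_smul, QuadraticMap.map_smul, ← smul_sub, smul_eq_mul, _root_.map_mul,
            ← sq, sqrtF_pow_two]
          rfl }
    obtain ⟨b, hb⟩ := exists_sympForm_eq f
    refine ⟨b, Forms.ext fun x ↦ ?_⟩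
    rw [addSq_apply, hb]
    change Q.1 x + sqrtF F (R.1 x - Q.1 x) ^ 2 = _
    rw [sqrtF_sq]
    ring

instance : Finite (Forms m F) :=
  Finite.of_injective (fun Q x ↦ Q.1 x : Forms m F → V m F → F) fun _ _ h ↦
    Forms.ext fun x ↦ congrFun h x

instance : Fintype (Forms m F) := Fintype.ofFinite _

instance : Fintype (Sp m F) := by
  classical exact Fintype.ofFinite _

lemma card_forms (Q : Forms m F) : Nat.card (Forms m F) = Nat.card (V m F) :=
  (Nat.card_congr (Equiv.ofBijective _ Q.addSq_bijective)).symm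

/-- Orthogonality of the functions `ψ ∘ Q` for distinct forms `Q`. -/
lemma Forms.sum_addChar_sub {Q R : Forms m F} (h : Q ≠ R) :
    ∑ x : V m F, addCharF F (Q.1 x - R.1 x) = 0 := by
  -- Since Q and R have the same polar form, Q − R is additive, and the sum is one over a character
  -- of V.
  let χ : AddChar (V m F) ℂ :=
    { toFun := fun x ↦ addCharF F (Q.1 x - R.1 x)
      map_zero_eq_one' := by simp
      map_add_eq_mul' := fun x y ↦ by
        rw [← AddChar.map_add_eq_mul, R.map_add, Q.map_add]
        congr 1
        ring }
  refine AddChar.sum_eq_zero_of_ne_one (ψ := χ) fun hχ ↦ h (Forms.ext fun x ↦ ?_)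
  by_contra hx
  rw [← sub_eq_zero] at hx
  refine addCharF_ne_one (F := F) (DFunLike.ext _ _ fun c ↦ ?_)
  -- The scalar √(c/(Q(x) − R(x))) moves x to a vector where Q − R takes the prescribed value c.
  have := DFunLike.congr_fun hχ (sqrtF F (c * (Q.1 x - R.1 x)⁻¹) • x)
  change addCharF F _ = 1 at this
  rw [QuadraticMap.map_smul, QuadraticMap.map_smul, ← smul_sub, smul_eq_mul, ← sq, sqrtF_sq,
    inv_mul_cancel_right₀ hx] at this
  simpa using this

/-- The intertwining map `Q ↦ ∑ ψ(Q x) x` from the module of forms to the module of vectors. -/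
def formsToVectors (m : ℕ) (F : Type*) [Field F] [CharP F 2] [Fintype F] :
    IntertwiningMap (permModule (Sp m F) (Forms m F)) (permModule (Sp m F) (V m F)) where
  toLinearMap := Finsupp.linearCombination ℂ
    (fun Q : Forms m F ↦ ∑ x : V m F, single x (addCharF F (Q.1 x))) ∘ₗ
      (coeffLinearEquiv ℂ).toLinearMap
  isIntertwining' g := by
    refine MonoidAlgebra.lhom_ext' fun Q ↦ LinearMap.ext_ring ?_
    simp [Forms.smul_apply]
    exact Fintype.sum_equiv (MulAction.toPerm g⁻¹) _ _ fun x ↦ by simp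

lemma formsToVectors_injective : Function.Injective (formsToVectors m F) := by
  have key (f : MonoidAlgebra ℂ (Forms m F)) (x : V m F) :
      (formsToVectors m F f).coeff x = ∑ Q, f.coeff Q * addCharF F (Q.1 x) := by
    classical
    change (Finsupp.linearCombination ℂ (fun Q : Forms m F ↦ ∑ x : V m F,
      single x (addCharF F (Q.1 x))) f.coeff : MonoidAlgebra ℂ (V m F)).coeff x = _
    rw [Finsupp.linearCombination_apply, Finsupp.sum_fintype _ _ (by simp)]
    simp [Finsupp.single_apply]
  change Function.Injective (formsToVectors m F).toLinearMap
  rw [injective_iff_map_eq_zero]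
  intro f hf
  refine MonoidAlgebra.ext (Finsupp.ext fun R ↦ ?_)
  have h0 (x : V m F) : ∑ Q, f.coeff Q * addCharF F (Q.1 x) = 0 := by
    rw [← key]
    change ((formsToVectors m F).toLinearMap f).coeff x = 0
    rw [hf]; rfl
  -- Multiplying the relation at x by ψ(−R(x)) and summing over x isolates the coefficient of R, by
  -- orthogonality.
  have h1 : ∑ Q, f.coeff Q * ∑ x : V m F, addCharF F (Q.1 x - R.1 x) = 0 := by
    simp_rw [Finset.mul_sum]
    rw [Finset.sum_comm]
    refine Finset.sum_eq_zero fun x _ ↦ ?_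
    have := congrArg (· * addCharF F (-R.1 x)) (h0 x)
    simpa [Finset.sum_mul, mul_assoc, ← AddChar.map_add_eq_mul, ← sub_eq_add_neg] using this
  rw [Finset.sum_eq_single R (fun Q _ hQ ↦ by rw [Forms.sum_addChar_sub hQ, mul_zero])
    (by simp)] at h1
  simpa using h1

/-- The permutation modules on forms and on vectors are isomorphic. -/
def formsEquivVectors (Q : Forms m F) :
    (permModule (Sp m F) (Forms m F)).Equiv (permModule (Sp m F) (V m F)) :=
  (formsToVectors m F).ofBijective ⟨formsToVectors_injective,
    (LinearMap.injective_iff_surjective_of_finrank_eq_finrank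
      (f := (formsToVectors m F).toLinearMap) (by
        rw [finrank_monoidAlgebra, finrank_monoidAlgebra, card_forms Q])).1
      formsToVectors_injective⟩

/-- The symplectic group has two orbits on forms. -/
lemma Forms.mem_orbit_or {Qp Qm : Forms m F} (h : Qm ∉ MulAction.orbit (Sp m F) Qp)
    (Q : Forms m F) : Q ∈ MulAction.orbit (Sp m F) Qp ∨ Q ∈ MulAction.orbit (Sp m F) Qm := by
  -- The number of orbits is the inner product of the permutation character with 1, so it agrees for
  -- isomorphic permutation modules.
  have hle : Nat.card (MulAction.orbitRel.Quotient (Sp m F) (Forms m F)) ≤ 2 := by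
    have := charInner_permChar_one (G := Sp m F) (X := Forms m F)
    rw [permChar, char_iso (formsEquivVectors Qp), charInner_permChar_one] at this
    have : Nat.card (MulAction.orbitRel.Quotient (Sp m F) (V m F)) =
      Nat.card (MulAction.orbitRel.Quotient (Sp m F) (Forms m F)) := by exact_mod_cast this
    rw [← this]
    exact card_orbits_vectors_le
  by_contra! hQ
  let f : Fin 3 → MulAction.orbitRel.Quotient (Sp m F) (Forms m F) :=
    ![Quotient.mk'' Qp, Quotient.mk'' Qm, Quotient.mk'' Q]
  have h' : Qp ∉ MulAction.orbit (Sp m F) Qm := fun h' ↦ h (MulAction.mem_orbit_symm.1 h')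
  have hQ1 : Qp ∉ MulAction.orbit (Sp m F) Q := fun h' ↦ hQ.1 (MulAction.mem_orbit_symm.1 h')
  have hQ2 : Qm ∉ MulAction.orbit (Sp m F) Q := fun h' ↦ hQ.2 (MulAction.mem_orbit_symm.1 h')
  have hf : Function.Injective f := by
    intro i j
    fin_cases i <;> fin_cases j <;>
      simp [f, Quotient.eq'', MulAction.orbitRel_apply, h, h', hQ, hQ1, hQ2]
  have := Nat.card_le_card_of_injective f hf
  rw [Nat.card_fin] at this
  omega

/-- The forms are the disjoint union of the two coset spaces. -/
def Forms.cosetsEquiv {Qp Qm : Forms m F} (h : Qm ∉ MulAction.orbit (Sp m F) Qp) :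
    (Sp m F ⧸ orthogonalSubgroup Qp.1) ⊕ (Sp m F ⧸ orthogonalSubgroup Qm.1) ≃ Forms m F :=
  Equiv.ofBijective (Sum.elim Qp.ofCoset Qm.ofCoset) <| by
    constructor
    · refine Qp.ofCoset_injective.sumElim Qm.ofCoset_injective fun a b hab ↦ h ?_
      have ha : Qp.ofCoset a ∈ MulAction.orbit (Sp m F) Qp := Qp.range_ofCoset ▸ ⟨a, rfl⟩
      have hb : Qm.ofCoset b ∈ MulAction.orbit (Sp m F) Qm := Qm.range_ofCoset ▸ ⟨b, rfl⟩
      rw [← hab, MulAction.mem_orbit_symm] at hb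
      rw [← MulAction.orbit_eq_iff.2 ha]
      exact hb
    · intro Q
      rcases Forms.mem_orbit_or h Q with hQ | hQ
      · rw [← Forms.range_ofCoset] at hQ
        exact ⟨.inl hQ.choose, hQ.choose_spec⟩
      · rw [← Forms.range_ofCoset] at hQ
        exact ⟨.inr hQ.choose, hQ.choose_spec⟩

/-- The permutation module on vectors is the sum of those on the two coset spaces. -/
def vectorsEquivCosets {Qp Qm : Forms m F} (h : Qm ∉ MulAction.orbit (Sp m F) Qp) :
    (permModule (Sp m F) (V m F)).Equiv
      ((permModule (Sp m F) (Sp m F ⧸ orthogonalSubgroup Qp.1)).prod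
        (permModule (Sp m F) (Sp m F ⧸ orthogonalSubgroup Qm.1))) :=
  (formsEquivVectors Qp).symm.trans <|
    permModuleProd (Forms.cosetsEquiv h) (fun g c ↦ Qp.ofCoset_smul g c)
      fun g c ↦ Qm.ofCoset_smul g c

lemma permChar_vectors {Qp Qm : Forms m F} (h : Qm ∉ MulAction.orbit (Sp m F) Qp) :
    permChar (Sp m F) (V m F) = permChar (Sp m F) (Sp m F ⧸ orthogonalSubgroup Qp.1) +
        permChar (Sp m F) (Sp m F ⧸ orthogonalSubgroup Qm.1) := by
  rw [permChar, char_iso (vectorsEquivCosets h), character_prod]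

end CharTwo

end Forms

/-! ### Artin–Schreier values, a Gauss sum, and |Ω⁻| < |Ω⁺| -/

section Degrees

open scoped Classical

variable {m : ℕ} {F : Type*} [Field F] [CharP F 2]

/-- The additive map `s ↦ s² + s`. -/
def artinSchreier (F : Type*) [Field F] [CharP F 2] : F →+ F where
  toFun s := s ^ 2 + s
  map_zero' := by simp
  map_add' x y := by rw [CharTwo.add_sq]; ring

lemma artinSchreier_apply (s : F) : artinSchreier F s = s ^ 2 + s := rfl

/-- The kernel is {0, 1}, and the index of the image of an endomorphism of a finite group is the
order of its kernel. -/
lemma index_range_artinSchreier [Fintype F] : (artinSchreier F).range.index = 2 := by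
  have hker : Nat.card (artinSchreier F).ker = 2 := by
    have : ((artinSchreier F).ker : Set F) = {0, 1} := by
      ext x
      simp only [SetLike.mem_coe, AddMonoidHom.mem_ker, artinSchreier_apply, Set.mem_insert_iff,
        Set.mem_singleton_iff]
      rw [show x ^ 2 + x = x * (x + 1) by ring, mul_eq_zero, CharTwo.add_eq_zero]
    rw [← SetLike.coe_sort_coe, this, Nat.card_coe_set_eq, Set.ncard_pair zero_ne_one]
  have h1 := (artinSchreier F).ker.card_mul_index
  have h2 := (artinSchreier F).range.card_mul_index
  rw [AddSubgroup.index_ker, hker, ← h2, mul_comm] at h1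
  exact (Nat.eq_of_mul_eq_mul_left Nat.card_pos h1).symm

/-- The quadratic additive character of a finite field of characteristic two. -/
def signChar (F : Type*) [Field F] [CharP F 2] [Fintype F] : AddChar F ℤ where
  toFun c := if c ∈ (artinSchreier F).range then 1 else -1
  map_zero_eq_one' := by simp [zero_mem]
  map_add_eq_mul' a b := by
    have := AddSubgroup.add_mem_iff_of_index_two (a := a) (b := b)
      (index_range_artinSchreier (F := F))
    by_cases ha : a ∈ (artinSchreier F).range <;> by_cases hb : b ∈ (artinSchreier F).range <;>
      simp [this, ha, hb]

lemma signChar_apply [Fintype F] (c : F) :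
    signChar F c = if c ∈ (artinSchreier F).range then 1 else -1 := rfl

lemma exists_signChar_ne_one (F : Type*) [Field F] [CharP F 2] [Fintype F] :
    ∃ c : F, signChar F c ≠ 1 := by
  by_contra! h
  have htop : (artinSchreier F).range = ⊤ := by
    refine eq_top_iff.2 fun c _ ↦ ?_
    by_contra hc
    have := h c
    rw [signChar_apply, if_neg hc] at this
    norm_num at this
  have := index_range_artinSchreier (F := F)
  rw [htop, AddSubgroup.index_top] at this
  norm_num at this

/-- Composing Q with x ↦ x + t(x, b)b gives Q + (t²Q(b) + t)(·, b)². The coefficient is 1 for t =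
s/Q(b) where s² + s = Q(b), or for t = 1 if Q(b) = 0. -/
lemma Forms.addSq_mem_orbit (Q : Forms m F) {b : V m F} (hb : Q.1 b ∈ (artinSchreier F).range) :
    Q.addSq b ∈ MulAction.orbit (Sp m F) Q := by
  have : ∃ t : F, t ^ 2 * Q.1 b + t = 1 := by
    by_cases h0 : Q.1 b = 0
    · exact ⟨1, by simp [h0]⟩
    · obtain ⟨s, hs⟩ := hb
      rw [artinSchreier_apply] at hs
      refine ⟨s / Q.1 b, ?_⟩
      field_simp
      rw [← hs]
      ring
  obtain ⟨t, ht⟩ := this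
  refine ⟨(transvection t b)⁻¹, Forms.ext fun x ↦ ?_⟩
  simp only
  rw [smul_apply, inv_inv, transvection_smul, Q.map_add, QuadraticMap.map_smul, addSq_apply,
    sympForm_smul_right, smul_eq_mul]
  linear_combination sympForm x b ^ 2 * ht

/-- An isotropic subspace of dimension m equals its orthogonal complement, whose dimension is 2m −
m. -/
lemma mem_of_forall_sympForm_eq_zero {W : Submodule F (V m F)} (hW : Module.finrank F W = m)
    (hiso : ∀ x ∈ W, ∀ y ∈ W, sympForm x y = 0) {b : V m F} (hb : ∀ w ∈ W, sympForm b w = 0) :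
    b ∈ W := by
  have hle : W ≤ LinearMap.BilinForm.orthogonal (sympBilin m F) W := fun x hx y hy ↦ by
    rw [← sympForm_eq_sympBilin]
    exact hiso y hy x hx
  have hfin : Module.finrank F W = Module.finrank F (LinearMap.BilinForm.orthogonal (sympBilin m F) W) := by
    rw [LinearMap.BilinForm.finrank_orthogonal sympBilin_nondegenerate, hW,
      Module.finrank_fintype_fun_eq_card, Fintype.card_sum, Fintype.card_fin, Nat.add_sub_cancel]
  rw [Submodule.eq_of_le_of_finrank_eq hle hfin]
  intro w hw
  rw [← sympForm_eq_sympBilin, sympForm_comm]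
  exact hb w hw

variable [Fintype F]

/-- The sum is |W| for a totally singular W of dimension m: translating by W and using Q(b + w) =
Q(b) + (b, w), only the b in W⊥ = W survive, and Q vanishes there. -/
lemma Forms.sum_signChar_pos (Q : Forms m F) (hQ : IsPlusType Q.1) :
    0 < ∑ b : V m F, signChar F (Q.1 b) := by
  obtain ⟨W, hW, hWm⟩ := hQ.exists_singular
  have hiso : ∀ x ∈ W, ∀ y ∈ W, sympForm x y = 0 := fun x hx y hy ↦ by
    have := Q.map_add x y
    rw [hW x hx, hW y hy, hW _ (W.add_mem hx hy)] at this
    simpa using this.symm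
  have hinner (b : V m F) : ∑ w : W, signChar F (sympForm b w) =
      if b ∈ W then (Fintype.card W : ℤ) else 0 := by
    split_ifs with hb
    · simp [hiso b hb]
    · let χ : AddChar W ℤ :=
        { toFun := fun w ↦ signChar F (sympForm b w)
          map_zero_eq_one' := by simp [sympForm_zero_right]
          map_add_eq_mul' := fun x y ↦ by
            rw [← AddChar.map_add_eq_mul, ← sympForm_add_right]; rfl }
      refine AddChar.sum_eq_zero_of_ne_one (ψ := χ) fun hχ ↦ ?_
      have : ∃ w ∈ W, sympForm b w ≠ 0 := by
        by_contra! h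
        exact hb (mem_of_forall_sympForm_eq_zero hWm hiso h)
      obtain ⟨w, hw, hbw⟩ := this
      obtain ⟨c, hc⟩ := exists_signChar_ne_one F
      have := DFunLike.congr_fun hχ ((c / sympForm b w) • (⟨w, hw⟩ : W))
      change signChar F (sympForm b ((c / sympForm b w) • w)) = 1 at this
      rw [sympForm_smul_right, div_mul_cancel₀ _ hbw] at this
      exact hc this
  have hmul : (∑ b : V m F, signChar F (Q.1 b)) * (Fintype.card W : ℤ) =
      (Fintype.card W : ℤ) * Fintype.card W := by
    calc (∑ b : V m F, signChar F (Q.1 b)) * (Fintype.card W : ℤ)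
        = ∑ w : W, ∑ b : V m F, signChar F (Q.1 (b + w)) := by
          rw [Finset.sum_congr rfl fun (w : W) _ ↦ Fintype.sum_equiv (Equiv.addRight (w : V m F))
            (fun b ↦ signChar F (Q.1 (b + w))) (fun b ↦ signChar F (Q.1 b)) fun b ↦ rfl]
          simp [mul_comm]
      _ = ∑ b : V m F, signChar F (Q.1 b) * ∑ w : W, signChar F (sympForm b w) := by
          rw [Finset.sum_comm]
          refine Finset.sum_congr rfl fun b _ ↦ ?_
          rw [Finset.mul_sum]
          refine Finset.sum_congr rfl fun w _ ↦ ?_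
          rw [Q.map_add, hW w w.2, add_zero, AddChar.map_add_eq_mul]
      _ = ∑ b : V m F, if b ∈ W then (Fintype.card W : ℤ) else 0 := by
          refine Finset.sum_congr rfl fun b _ ↦ ?_
          rw [hinner]
          split_ifs with hb
          · rw [hW b hb, AddChar.map_zero_eq_one, one_mul]
          · rw [mul_zero]
      _ = _ := by
          rw [← Finset.sum_filter, Finset.sum_const, nsmul_eq_mul, ← Fintype.card_subtype]
  have hpos : (0 : ℤ) < Fintype.card W := by exact_mod_cast Fintype.card_pos
  rw [mul_right_cancel₀ hpos.ne' hmul]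
  exact hpos

/-- There are more forms of plus type than of minus type. -/
lemma card_cosets_lt {Qp Qm : Forms m F} (hp : IsPlusType Qp.1) (hm : IsMinusType Qm.1) :
    Nat.card (Sp m F ⧸ orthogonalSubgroup Qm.1) < Nat.card (Sp m F ⧸ orthogonalSubgroup Qp.1) := by
  have hsum := Nat.card_congr (Forms.cosetsEquiv (Forms.notMem_orbit_of_type hp hm))
  rw [Nat.card_sum, card_forms Qp] at hsum
  -- The b with Q(b) in the Artin–Schreier image give distinct forms in the plus orbit. By the
  -- positive sign sum they make up more than half of V, and there are |V| forms in all.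
  have hle : (Finset.univ.filter fun b : V m F ↦ Qp.1 b ∈ (artinSchreier F).range).card ≤
      Nat.card (Sp m F ⧸ orthogonalSubgroup Qp.1) := by
    rw [← Nat.card_range_of_injective Qp.ofCoset_injective, Qp.range_ofCoset, ← Fintype.card_subtype,
      ← Nat.card_eq_fintype_card]
    exact Nat.card_le_card_of_injective
      (fun b : {b : V m F // Qp.1 b ∈ (artinSchreier F).range} ↦
        (⟨Qp.addSq b, Qp.addSq_mem_orbit b.2⟩ : MulAction.orbit (Sp m F) Qp))
      fun a b hab ↦ Subtype.ext (Qp.addSq_bijective.1 (congrArg Subtype.val hab))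
  have hpos := Qp.sum_signChar_pos hp
  simp only [signChar_apply] at hpos
  rw [Finset.sum_ite, Finset.sum_const, Finset.sum_const] at hpos
  have htot := Finset.card_filter_add_card_filter_not (s := Finset.univ)
    fun b : V m F ↦ Qp.1 b ∈ (artinSchreier F).range
  rw [Finset.card_univ, ← Nat.card_eq_fintype_card] at htot
  simp only [nsmul_eq_mul, mul_one, mul_neg] at hpos
  omega

end Degrees

/-! ### Orthogonality for characters of a finite abelian group -/

section CharactersOfUnits

open scoped Classical

variable {A : Type*} [CommGroup A] [Fintype A]

instance : Fintype (A →* ℂˣ) := Fintype.ofFinite _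

lemma sum_character (η : A →* ℂˣ) :
    ∑ a, (η a : ℂ) = if η = 1 then (Fintype.card A : ℂ) else 0 := by
  have := sum_hom_units ((Units.coeHom ℂ).comp η)
  simp only [MonoidHom.comp_apply, Units.coeHom_apply, MonoidHom.ext_iff, MonoidHom.one_apply,
    Units.val_eq_one] at this
  simpa [MonoidHom.ext_iff] using this

lemma card_characters : Fintype.card (A →* ℂˣ) = Fintype.card A := by
  have := CommGroup.card_monoidHom_of_hasEnoughRootsOfUnity A ℂ
  simpa only [Nat.card_eq_fintype_card] using this

lemma sum_characters (a : A) :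
    ∑ η : A →* ℂˣ, (η a : ℂ) = if a = 1 then (Fintype.card A : ℂ) else 0 := by
  split_ifs with h
  · simp [h, card_characters]
  · obtain ⟨ξ, hξ⟩ := CommGroup.exists_apply_ne_one_of_hasEnoughRootsOfUnity A ℂ h
    have hmul : (ξ a : ℂ) * ∑ η : A →* ℂˣ, (η a : ℂ) = ∑ η : A →* ℂˣ, (η a : ℂ) := by
      rw [Finset.mul_sum]
      exact Fintype.sum_equiv (Equiv.mulLeft ξ) _ _ fun η ↦ by simp
    have h0 : ((ξ a : ℂ) - 1) * ∑ η : A →* ℂˣ, (η a : ℂ) = 0 := by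
      rw [sub_mul, hmul, one_mul, sub_self]
    refine (mul_eq_zero.1 h0).resolve_left fun h ↦ hξ ?_
    exact Units.ext (sub_eq_zero.1 h)

end CharactersOfUnits

/-! ### The characters θ_η and their inner products -/

section Theta

open scoped Classical

variable {m : ℕ} {F : Type*} [Field F]

/-- The nonzero vectors. -/
abbrev NV (m : ℕ) (F : Type*) [Field F] : Type _ := {u : V m F // u ≠ 0}

instance : MulAction (Sp m F) (NV m F) where
  smul g u := ⟨g • u.1, (smul_ne_zero_iff_ne g).2 u.2⟩
  one_smul u := Subtype.ext (one_smul _ u.1)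
  mul_smul g h u := Subtype.ext (mul_smul g h u.1)

lemma NV.coe_smul (g : Sp m F) (u : NV m F) : ((g • u : NV m F) : V m F) = g • (u : V m F) := rfl

lemma NV.coe_units_smul (a : Fˣ) (u : NV m F) :
    ((a • u : NV m F) : V m F) = (a : F) • (u : V m F) := rfl

lemma NV.smul_units_smul (g : Sp m F) (a : Fˣ) (u : NV m F) : g • a • u = a • g • u :=
  Subtype.ext (smul_comm g (a : F) (u : V m F))

lemma NV.units_smul_left_injective {a b : Fˣ} {u : NV m F} (h : a • u = b • u) : a = b :=
  Units.ext (smul_left_injective F u.2 (congrArg Subtype.val h))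

lemma NV.exists_smul_eq (u w : NV m F) : ∃ g : Sp m F, g • u = w := by
  obtain ⟨g, hg⟩ := SpOrthogonal.exists_smul_eq u.2 w.2
  exact ⟨g, Subtype.ext hg⟩

/-- The invariant of a pair of nonzero vectors: their ratio if they are dependent, and the value
of the symplectic form otherwise. -/
def pairInvariant (p : NV m F × NV m F) : Fˣ ⊕ F :=
  if h : ∃ c : Fˣ, p.2 = c • p.1 then .inl h.choose else .inr (sympForm p.1.1 p.2.1)

lemma pairInvariant_smul_self (u : NV m F) (c : Fˣ) : pairInvariant (u, c • u) = .inl c := by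
  have h : ∃ c' : Fˣ, c • u = c' • u := ⟨c, rfl⟩
  rw [pairInvariant, dif_pos h]
  exact congrArg _ (NV.units_smul_left_injective h.choose_spec).symm

lemma pairInvariant_of_not {u w : NV m F} (h : ¬ ∃ c : Fˣ, w = c • u) :
    pairInvariant (u, w) = .inr (sympForm u.1 w.1) :=
  dif_neg h

lemma linearIndependent_of_not {u w : NV m F} (h : ¬ ∃ c : Fˣ, w = c • u) :
    LinearIndependent F ![u.1, w.1] := by
  rw [LinearIndependent.pair_iff' u.2]
  intro c hc
  refine h ⟨Units.mk0 c ?_, Subtype.ext hc.symm⟩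
  rintro rfl
  exact w.2 (by rw [← hc, zero_smul])

/-- Scalars commute with the group, so scaling the two entries permutes the orbits on pairs. This is
the map on orbits needed for the twisted Burnside count. -/
lemma pairInvariant_twist (a b : Fˣ) (p : NV m F × NV m F) :
    pairInvariant (a • p.1, b • p.2) =
      Sum.map (fun c : Fˣ ↦ c * b * a⁻¹) (fun c : F ↦ a * b * c) (pairInvariant p) := by
  obtain ⟨u, w⟩ := p
  by_cases h : ∃ c : Fˣ, w = c • u
  · obtain ⟨c, rfl⟩ := h
    have : b • c • u = (c * b * a⁻¹) • a • u := by
      rw [smul_smul, smul_smul]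
      congr 1
      rw [inv_mul_cancel_right, mul_comm]
    simp only
    rw [this, pairInvariant_smul_self, pairInvariant_smul_self, Sum.map_inl]
  · have h' : ¬ ∃ c : Fˣ, b • w = c • a • u := by
      rintro ⟨c, hc⟩
      exact h ⟨b⁻¹ * c * a, by rw [mul_smul, mul_smul, ← hc, inv_smul_smul]⟩
    rw [pairInvariant_of_not h, pairInvariant_of_not h', Sum.map_inr]
    rw [NV.coe_units_smul, NV.coe_units_smul, sympForm_smul_left, sympForm_smul_right, mul_assoc]

lemma pairInvariant_eq_iff (p p' : NV m F × NV m F) :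
    pairInvariant p = pairInvariant p' ↔ ∃ g : Sp m F, g • p = p' := by
  obtain ⟨u, w⟩ := p
  obtain ⟨u', w'⟩ := p'
  constructor
  · intro hpp
    by_cases h : ∃ c : Fˣ, w = c • u <;> by_cases h' : ∃ c : Fˣ, w' = c • u'
    · obtain ⟨c, rfl⟩ := h
      obtain ⟨c', rfl⟩ := h'
      rw [pairInvariant_smul_self, pairInvariant_smul_self, Sum.inl.injEq] at hpp
      subst hpp
      obtain ⟨g, hg⟩ := NV.exists_smul_eq u u'
      exact ⟨g, by rw [Prod.smul_mk, NV.smul_units_smul, hg]⟩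
    · obtain ⟨c, rfl⟩ := h
      rw [pairInvariant_smul_self, pairInvariant_of_not h'] at hpp
      exact absurd hpp Sum.inl_ne_inr
    · obtain ⟨c, rfl⟩ := h'
      rw [pairInvariant_smul_self, pairInvariant_of_not h] at hpp
      exact absurd hpp Sum.inr_ne_inl
    · rw [pairInvariant_of_not h, pairInvariant_of_not h', Sum.inr.injEq] at hpp
      obtain ⟨g, hg, hg'⟩ := exists_smul_pair_eq (linearIndependent_of_not h)
        (linearIndependent_of_not h') hpp
      exact ⟨g, Prod.ext (Subtype.ext hg) (Subtype.ext hg')⟩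
  · rintro ⟨g, hg⟩
    rw [← hg, Prod.smul_mk]
    by_cases h : ∃ c : Fˣ, w = c • u
    · obtain ⟨c, rfl⟩ := h
      rw [NV.smul_units_smul, pairInvariant_smul_self, pairInvariant_smul_self]
    · have h' : ¬ ∃ c : Fˣ, g • w = c • g • u := by
        rintro ⟨c, hc⟩
        rw [← NV.smul_units_smul] at hc
        exact h ⟨c, smul_left_cancel g hc⟩
      rw [pairInvariant_of_not h, pairInvariant_of_not h', NV.coe_smul, NV.coe_smul,
        sympForm_smul_smul]

/-- The hypothesis 2 ≤ m enters for the value 0: independent orthogonal vectors need a second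
hyperbolic pair. The coordinate at `j` keeps w off the line of u for every c. -/
lemma pairInvariant_surjective (hm : 2 ≤ m) :
    Function.Surjective (pairInvariant : NV m F × NV m F → Fˣ ⊕ F) := by
  let i : Fin m := ⟨0, by omega⟩
  let j : Fin m := ⟨1, by omega⟩
  have hij : j ≠ i := by simp [i, j]
  let u : V m F := Pi.single (.inr i) 1
  have hu : u ≠ 0 := fun h ↦ by simpa [u] using congrFun h (.inr i)
  rintro (c | c)
  · exact ⟨(⟨u, hu⟩, c • ⟨u, hu⟩), pairInvariant_smul_self _ _⟩
  · let w : V m F := Pi.single (.inl i) c + Pi.single (.inr j) 1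
    have hwj : w (.inr j) = 1 := by simp [w]
    have huj : u (.inr j) = 0 := by simp [u, hij]
    have hw : w ≠ 0 := fun h ↦ by simp [h] at hwj
    refine ⟨(⟨u, hu⟩, ⟨w, hw⟩), ?_⟩
    rw [pairInvariant_of_not]
    · congr 1
      rw [sympForm_apply, Finset.sum_eq_single i]
      · simp [u, w]
      · intro k _ hk
        simp [u, hk]
      · simp
    · rintro ⟨a, ha⟩
      have := congrFun (congrArg Subtype.val ha) (.inr j)
      change w (.inr j) = a * u (.inr j) at this
      simp [hwj, huj] at this

variable [Fintype F]

instance : Fintype (NV m F) := Fintype.ofFinite _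

/-- The number of nonzero vectors `u` with `g u = a u`. -/
def eigenCount (g : Sp m F) (a : Fˣ) : ℂ := ∑ u : NV m F, if g • u = a • u then 1 else 0

/-- The character `g ↦ (q - 1)⁻¹ ∑ η(a) |{u ≠ 0 | g u = a u}|`. -/
def theta (m : ℕ) {F : Type*} [Field F] [Fintype F] (η : Fˣ →* ℂˣ) (g : Sp m F) : ℂ :=
  (Fintype.card Fˣ : ℂ)⁻¹ * ∑ a, (η a : ℂ) * eigenCount g a

lemma card_units_ne_zero : (Fintype.card Fˣ : ℂ) ≠ 0 :=
  Nat.cast_ne_zero.2 Fintype.card_ne_zero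

/-- If g u = a u then g⁻¹ u = a⁻¹ u, so inverting g amounts to inverting η. -/
lemma theta_inv (η : Fˣ →* ℂˣ) (g : Sp m F) :
    theta m η g⁻¹ = (Fintype.card Fˣ : ℂ)⁻¹ * ∑ a, (η⁻¹ a : ℂ) * eigenCount g a := by
  rw [theta]
  congr 1
  refine Fintype.sum_equiv (Equiv.inv _) _ _ fun a ↦ ?_
  simp only [Equiv.inv_apply, MonoidHom.inv_apply, map_inv, inv_inv]
  congr 1
  refine Finset.sum_congr rfl fun u _ ↦ ?_
  congr 1
  rw [inv_smul_eq_iff, NV.smul_units_smul, eq_inv_smul_iff]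
  exact propext eq_comm

lemma sum_eigenCount_mul (hm : 2 ≤ m) (a b : Fˣ) :
    ∑ g : Sp m F, eigenCount g a * eigenCount g b = Nat.card (Sp m F) *
      ((if a = b then (Fintype.card Fˣ : ℂ) else 0) + 1 +
        if a * b = 1 then (Fintype.card Fˣ : ℂ) else 0) := by
  have key := sum_smul_eq_twist (G := Sp m F) (pairInvariant : NV m F × NV m F → Fˣ ⊕ F)
    (pairInvariant_surjective hm) pairInvariant_eq_iff (fun p ↦ (a • p.1, b • p.2)) _
    (pairInvariant_twist a b)
  -- Ratios are all fixed if a = b, otherwise none is. Form values are all fixed if ab = 1,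
  -- otherwise only 0 is; the summand 1 is this ever-present 0, and q = (q − 1) + 1.
  have hcount : (∑ i : Fˣ ⊕ F, if Sum.map (fun c : Fˣ ↦ c * b * a⁻¹) (fun c : F ↦ a * b * c) i = i
      then (1 : ℂ) else 0) = (if a = b then (Fintype.card Fˣ : ℂ) else 0) + 1 +
        if a * b = 1 then (Fintype.card Fˣ : ℂ) else 0 := by
    rw [Fintype.sum_sum_type, add_assoc]
    congr 1
    · simp only [Sum.map_inl, Sum.inl.injEq, mul_assoc, mul_eq_left, mul_inv_eq_one]
      split_ifs with h1 h2 h2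
      · simp
      · exact absurd h1.symm h2
      · exact absurd h2.symm h1
      · simp
    · simp only [Sum.map_inr, Sum.inr.injEq]
      have hsplit (c : F) : (a : F) * b * c = c ↔ c = 0 ∨ a * b = 1 := by
        by_cases hc : c = 0
        · simp [hc]
        · rw [mul_eq_right₀ hc, Units.ext_iff]
          simp [hc]
      simp only [hsplit]
      split_ifs with h
      · simp [h, Fintype.card_eq_card_units_add_one, add_comm]
      · simp [h]
  rw [← hcount]
  refine (Eq.trans ?_ key).trans (by congr!)
  refine Finset.sum_congr rfl fun g _ ↦ ?_
  rw [eigenCount, eigenCount, Finset.sum_mul_sum, Fintype.sum_prod_type]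
  refine Finset.sum_congr rfl fun x _ ↦ Finset.sum_congr rfl fun y _ ↦ ?_
  simp only [Prod.smul_mk, Prod.mk_inj, ite_and]
  split_ifs <;> simp

/-- The inner products of the characters `theta`. -/
lemma charInner_theta (hm : 2 ≤ m) (η ξ : Fˣ →* ℂˣ) :
    charInner (theta m η) (theta m ξ) = (if η = ξ then 1 else 0) +
      (if η = 1 ∧ ξ = 1 then 1 else 0) + if η * ξ = 1 then 1 else 0 := by
  have hN : (Nat.card (Sp m F) : ℂ) ≠ 0 := Nat.cast_ne_zero.2 Nat.card_pos.ne'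
  have hq := card_units_ne_zero (F := F)
  have h1 : ∑ g : Sp m F, theta m η g * theta m ξ g⁻¹ = (Fintype.card Fˣ : ℂ)⁻¹ ^ 2 *
      ∑ a, ∑ b, (η a : ℂ) * (ξ⁻¹ b : ℂ) * ∑ g : Sp m F, eigenCount g a * eigenCount g b := by
    have (g : Sp m F) : theta m η g * theta m ξ g⁻¹ = (Fintype.card Fˣ : ℂ)⁻¹ ^ 2 *
        ∑ a, ∑ b, (η a : ℂ) * (ξ⁻¹ b : ℂ) * (eigenCount g a * eigenCount g b) := by
      rw [theta_inv, theta, mul_mul_mul_comm, Finset.sum_mul_sum, ← sq]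
      congr 1
      exact Finset.sum_congr rfl fun a _ ↦ Finset.sum_congr rfl fun b _ ↦ by ring
    rw [Finset.sum_congr rfl fun g _ ↦ this g, ← Finset.mul_sum, Finset.sum_comm]
    congr 1
    refine Finset.sum_congr rfl fun a _ ↦ ?_
    rw [Finset.sum_comm]
    exact Finset.sum_congr rfl fun b _ ↦ (Finset.mul_sum ..).symm
  have h2 : ∑ a, ∑ b, (η a : ℂ) * (ξ⁻¹ b : ℂ) *
      ((if a = b then (Fintype.card Fˣ : ℂ) else 0) + 1 +
        if a * b = 1 then (Fintype.card Fˣ : ℂ) else 0) =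
      (Fintype.card Fˣ : ℂ) * ∑ a, ((η * ξ⁻¹) a : ℂ) + (∑ a, (η a : ℂ)) * ∑ b, (ξ⁻¹ b : ℂ) +
        (Fintype.card Fˣ : ℂ) * ∑ a, ((η * ξ) a : ℂ) := by
    simp_rw [mul_add, Finset.sum_add_distrib, mul_one]
    congr 1
    · congr 1
      · rw [Finset.mul_sum]
        refine Finset.sum_congr rfl fun a _ ↦ ?_
        simp [mul_comm]
      · rw [Finset.sum_mul_sum]
    · rw [Finset.mul_sum]
      refine Finset.sum_congr rfl fun a _ ↦ ?_
      simp_rw [mul_eq_one_iff_inv_eq]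
      simp [mul_comm]
  rw [charInner, h1]
  simp_rw [sum_eigenCount_mul hm, mul_left_comm _ (Nat.card (Sp m F) : ℂ), ← Finset.mul_sum]
  rw [h2, sum_character, sum_character, sum_character, sum_character, mul_left_comm,
    inv_mul_cancel_left₀ hN]
  have e1 : η * ξ⁻¹ = 1 ↔ η = ξ := by
    simp only [MonoidHom.ext_iff, MonoidHom.mul_apply, MonoidHom.inv_apply, MonoidHom.one_apply,
      mul_inv_eq_one]
  have e2 : ξ⁻¹ = 1 ↔ ξ = 1 := by
    simp only [MonoidHom.ext_iff, MonoidHom.inv_apply, MonoidHom.one_apply, inv_eq_one]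
  simp only [e1, e2]
  rw [mul_add, mul_add]
  congr 1
  · congr 1
    · split_ifs
      · field_simp
      · simp
    · rw [ite_and]
      split_ifs
      · field_simp
      all_goals simp
  · split_ifs
    · field_simp
    · simp

/-- A vector spans a fixed line exactly when it is an eigenvector, for a unique eigenvalue, and each
line contains q − 1 nonzero vectors. -/
lemma permChar_proj : permChar (Sp m F) (ℙ F (V m F)) = theta m (1 : Fˣ →* ℂˣ) := by
  have := Fintype.ofFinite (ℙ F (V m F))
  ext g
  have h1 : ∑ a : Fˣ, eigenCount g a =
      ∑ u : NV m F, if g • Projectivization.mk F u.1 u.2 = Projectivization.mk F u.1 u.2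
        then (1 : ℂ) else 0 := by
    simp only [eigenCount]
    rw [Finset.sum_comm]
    refine Finset.sum_congr rfl fun u _ ↦ ?_
    split_ifs with h
    · rw [Projectivization.smul_mk, Projectivization.mk_eq_mk_iff] at h
      obtain ⟨a, ha⟩ := h
      rw [Finset.sum_eq_single a]
      · exact if_pos (Subtype.ext ha.symm)
      · intro b _ hb
        refine if_neg fun hb' ↦ hb (NV.units_smul_left_injective (u := u) ?_)
        rw [← hb']
        exact Subtype.ext ha.symm
      · simp
    · refine Finset.sum_eq_zero fun a _ ↦ if_neg fun ha ↦ h ?_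
      rw [Projectivization.smul_mk, Projectivization.mk_eq_mk_iff]
      exact ⟨a, (congrArg Subtype.val ha).symm⟩
  let f : ℙ F (V m F) × Fˣ → NV m F := fun p ↦ p.2 • ⟨p.1.rep, p.1.rep_nonzero⟩
  have hmk (p : ℙ F (V m F) × Fˣ) : Projectivization.mk F (f p).1 (f p).2 = p.1 := by
    conv_rhs => rw [← p.1.mk_rep]
    rw [Projectivization.mk_eq_mk_iff]
    exact ⟨p.2, rfl⟩
  have hf : Function.Bijective f := by
    constructor
    · rintro ⟨l, a⟩ ⟨l', a'⟩ h
      have hl : l = l' := by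
        have h1 := hmk (l, a)
        have h2 := hmk (l', a')
        simp only [h] at h1 h2
        exact h1.symm.trans h2
      subst hl
      exact congrArg _ (NV.units_smul_left_injective h)
    · intro u
      obtain ⟨a, ha⟩ := Projectivization.exists_smul_eq_mk_rep F u.1 u.2
      refine ⟨(.mk F u.1 u.2, a⁻¹), Subtype.ext ?_⟩
      change a⁻¹ • (Projectivization.mk F u.1 u.2).rep = u.1
      rw [← ha, inv_smul_smul]
  rw [theta]
  simp only [MonoidHom.one_apply, Units.val_one, one_mul]
  rw [h1, ← hf.sum_comp, Fintype.sum_prod_type, permChar_apply]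
  simp only [hmk, Finset.sum_const, Finset.card_univ, nsmul_eq_mul]
  rw [← Finset.mul_sum, inv_mul_cancel_left₀ card_units_ne_zero]

/-- Summing over all η leaves only the eigenvalue a = 1, that is, the fixed nonzero vectors; the
summand 1 counts the zero vector. -/
lemma permChar_vectors_eq_sum :
    permChar (Sp m F) (V m F) = 1 + ∑ η : Fˣ →* ℂˣ, theta m η := by
  ext g
  have h1 : (∑ η : Fˣ →* ℂˣ, theta m η) g = eigenCount g 1 := by
    simp only [Finset.sum_apply, theta]
    rw [← Finset.mul_sum, Finset.sum_comm]
    simp_rw [← Finset.sum_mul, sum_characters]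
    simp
  rw [Pi.add_apply, h1, permChar_apply, Pi.one_apply,
    ← Finset.add_sum_erase Finset.univ _ (Finset.mem_univ (0 : V m F)),
    Finset.sum_subtype (p := (· ≠ 0)) (Finset.univ.erase 0) (F := (inferInstance : Fintype (NV m F))) (by simp),
    smul_zero, if_pos rfl]
  simp only [eigenCount, one_smul, Subtype.ext_iff, NV.coe_smul]
  congr!

end Theta

/-! ### Induction from the parabolic subgroup -/

section Parabolic

open Representation MonoidAlgebra
open scoped Classical

variable {m : ℕ} {F : Type*} [Field F] {v : V m F} {hv : v ≠ 0}

lemma exists_units_smul_eq (p : parabolic v hv) : ∃ a : Fˣ, a • v = (p : Sp m F) • v := by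
  have := p.2
  rwa [MulAction.mem_stabilizer_iff, Projectivization.smul_mk,
    Projectivization.mk_eq_mk_iff] at this

/-- The eigenvalue of an element of the parabolic subgroup on the fixed line. -/
def eigenvalue (v : V m F) (hv : v ≠ 0) : parabolic v hv →* Fˣ :=
  .mk' (fun p ↦ (exists_units_smul_eq p).choose) fun p r ↦ by
    refine NV.units_smul_left_injective (u := ⟨v, hv⟩) (Subtype.ext ?_)
    change (exists_units_smul_eq (p * r)).choose • v = _ • v
    rw [(exists_units_smul_eq (p * r)).choose_spec, mul_comm, mul_smul,
      (exists_units_smul_eq p).choose_spec, Subgroup.coe_mul, mul_smul]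
    refine (congrArg _ (exists_units_smul_eq r).choose_spec.symm).trans ?_
    exact smul_comm (p : Sp m F) ((exists_units_smul_eq r).choose : F) v

lemma eigenvalue_smul (p : parabolic v hv) : eigenvalue v hv p • v = (p : Sp m F) • v :=
  (exists_units_smul_eq p).choose_spec

lemma eigenvalue_eq {p : parabolic v hv} {a : Fˣ} (h : (p : Sp m F) • v = a • v) :
    eigenvalue v hv p = a :=
  NV.units_smul_left_injective (u := ⟨v, hv⟩) (Subtype.ext ((eigenvalue_smul p).trans h))

lemma eigenvalue_surjective : Function.Surjective (eigenvalue v hv) := by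
  intro a
  obtain ⟨g, hg⟩ := exists_smul_eq hv (a • (⟨v, hv⟩ : NV m F)).2
  refine ⟨⟨g, ?_⟩, eigenvalue_eq hg⟩
  rw [MulAction.mem_stabilizer_iff, Projectivization.smul_mk, Projectivization.mk_eq_mk_iff]
  exact ⟨a, hg.symm⟩

lemma comp_eigenvalue_injective {η ξ : Fˣ →* ℂˣ}
    (h : η.comp (eigenvalue v hv) = ξ.comp (eigenvalue v hv)) : η = ξ :=
  (MonoidHom.cancel_right eigenvalue_surjective).1 h

/-- The characters of the parabolic subgroup which are trivial on the stabilizer of `v` are those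
which factor through the eigenvalue. -/
lemma isNontrivialModStabilizer_iff {ζ : parabolic v hv →* ℂˣ} :
    IsNontrivialModStabilizer ζ ↔ ∃ η : Fˣ →* ℂˣ, η ≠ 1 ∧ η.comp (eigenvalue v hv) = ζ := by
  constructor
  · rintro ⟨h1, h⟩
    let η := (eigenvalue v hv).liftOfSurjective eigenvalue_surjective
      ⟨ζ, fun p hp ↦ h p (by rw [← eigenvalue_smul, MonoidHom.mem_ker.1 hp, one_smul])⟩
    have hη : η.comp (eigenvalue v hv) = ζ := MonoidHom.liftOfRightInverse_comp ..
    refine ⟨η, ?_, hη⟩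
    rintro hη1
    rw [hη1, MonoidHom.one_comp] at hη
    exact h1 hη.symm
  · rintro ⟨η, hη, rfl⟩
    refine ⟨fun h ↦ hη (comp_eigenvalue_injective (v := v) (hv := hv) ?_), fun g hg ↦ ?_⟩
    · rw [h, MonoidHom.one_comp]
    · rw [MonoidHom.comp_apply, eigenvalue_eq (a := 1) (by rw [hg, one_smul]), map_one]

lemma Forms.exists_ne_zero (Q : Forms m F) (hv : v ≠ 0) : ∃ k : Sp m F, Q.1 (k • v) ≠ 0 := by
  by_contra! h
  have h0 (u : V m F) : Q.1 u = 0 := by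
    by_cases hu : u = 0
    · simp [hu]
    · obtain ⟨k, rfl⟩ := exists_smul_eq hv hu
      exact h k
  obtain ⟨y, hy⟩ := exists_sympForm_ne_zero hv
  have := Q.map_add v y
  simp only [h0, zero_add] at this
  exact hy this.symm

variable [Fintype F]

lemma conjChar_comp_eigenvalue (η : Fˣ →* ℂˣ) :
    conjChar (η.comp (eigenvalue v hv)) = η⁻¹.comp (eigenvalue v hv) := by
  ext p
  have : η (eigenvalue v hv p) ∈ rootsOfUnity (Fintype.card Fˣ) ℂ := by
    rw [mem_rootsOfUnity, ← map_pow, pow_card_eq_one, map_one]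
  have := Complex.conj_rootsOfUnity this
  simpa [conjChar] using this

variable (η : Fˣ →* ℂˣ)

/-- The semi-invariant vector `(q - 1)⁻¹ ∑ η(a)⁻¹ a v`. -/
def semiInvariant (u : NV m F) : MonoidAlgebra ℂ (NV m F) :=
  (Fintype.card Fˣ : ℂ)⁻¹ • ∑ a : Fˣ, single (a • u) ((η a : ℂ)⁻¹)

lemma smul_semiInvariant (g : Sp m F) (u : NV m F) :
    permModule (Sp m F) (NV m F) g (semiInvariant η u) = semiInvariant η (g • u) := by
  simp [semiInvariant, NV.smul_units_smul]

lemma semiInvariant_units_smul (b : Fˣ) (u : NV m F) :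
    semiInvariant η (b • u) = (η b : ℂ) • semiInvariant η u := by
  rw [semiInvariant, semiInvariant, smul_comm (η b : ℂ)]
  congr 1
  rw [Finset.smul_sum]
  refine Fintype.sum_equiv (Equiv.mulRight b) _ _ fun a ↦ ?_
  simp [smul_smul]

lemma semiInvariant_spec (p : parabolic v hv) :
    permModule (Sp m F) (NV m F) p (semiInvariant η ⟨v, hv⟩) =
      ((η.comp (eigenvalue v hv)) p : ℂ) • semiInvariant η ⟨v, hv⟩ := by
  rw [smul_semiInvariant, MonoidHom.comp_apply, ← semiInvariant_units_smul]
  congr 1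
  exact Subtype.ext (eigenvalue_smul p).symm

/-- A generator depends, up to a value of η, only on the line of the image of v. This makes
`toInduced` independent of the chosen group elements. -/
lemma indMk_inv_eq {h k : Sp m F} {b : Fˣ} (hb : k • v = b • h • v) :
    indMk (η.comp (eigenvalue v hv)) k⁻¹ =
      (η b : ℂ) • indMk (η.comp (eigenvalue v hv)) h⁻¹ := by
  have hv' : (k⁻¹ * h) • v = b⁻¹ • v := by
    rw [mul_smul, inv_smul_eq_iff]
    have : k • b⁻¹ • v = b⁻¹ • k • v := smul_comm k ((b⁻¹ : Fˣ) : F) v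
    rw [this, hb, inv_smul_smul]
  have hp : k⁻¹ * h ∈ parabolic v hv := by
    rw [MulAction.mem_stabilizer_iff, Projectivization.smul_mk, Projectivization.mk_eq_mk_iff]
    exact ⟨b⁻¹, hv'.symm⟩
  have := indMk_mul (η.comp (eigenvalue v hv)) ⟨k⁻¹ * h, hp⟩ h⁻¹
  rw [MonoidHom.comp_apply, eigenvalue_eq (p := ⟨k⁻¹ * h, hp⟩) hv', map_inv,
    Units.val_inv_eq_inv_val, inv_inv] at this
  simpa using this

/-- The projection from the permutation module on nonzero vectors to an induced module. -/
def toInduced (v : V m F) (hv : v ≠ 0) : MonoidAlgebra ℂ (NV m F) →ₗ[ℂ]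
    IndV (parabolic v hv).subtype (linearRep (η.comp (eigenvalue v hv))) :=
  Finsupp.linearCombination ℂ (fun u ↦ indMk (η.comp (eigenvalue v hv))
    (NV.exists_smul_eq ⟨v, hv⟩ u).choose⁻¹) ∘ₗ (coeffLinearEquiv ℂ).toLinearMap

lemma toInduced_single {u : NV m F} {h : Sp m F} {b : Fˣ} (hu : u.1 = b • h • v) :
    toInduced η v hv (single u 1) = (η b : ℂ) • indMk (η.comp (eigenvalue v hv)) h⁻¹ := by
  have hk := (NV.exists_smul_eq ⟨v, hv⟩ u).choose_spec
  rw [← indMk_inv_eq η (hv := hv) (h := h)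
    (k := (NV.exists_smul_eq ⟨v, hv⟩ u).choose) ((congrArg Subtype.val hk).trans hu)]
  simp [toInduced]

/-- The inclusion of an induced module in the permutation module on nonzero vectors. -/
def ofInduced (v : V m F) (hv : v ≠ 0) :
    IntertwiningMap (inducedRep (η.comp (eigenvalue v hv))) (permModule (Sp m F) (NV m F)) :=
  indLift (semiInvariant_spec η)

lemma ofInduced_indMk (h : Sp m F) :
    ofInduced η v hv (indMk _ h) = semiInvariant η (h⁻¹ • ⟨v, hv⟩) := by
  rw [ofInduced, indLift_indMk, smul_semiInvariant]

/-- All q − 1 terms of the averaged vector map to the same generator, the factors η(a) and η(a)⁻¹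
cancelling. So the induced module is a direct summand of the functions on nonzero vectors. -/
lemma toInduced_comp_ofInduced :
    toInduced η v hv ∘ₗ (ofInduced η v hv).toLinearMap = LinearMap.id := by
  refine ind_linearMap_ext _ fun h ↦ ?_
  rw [LinearMap.comp_apply, IntertwiningMap.toLinearMap_apply, ofInduced_indMk, LinearMap.id_apply,
    semiInvariant, map_smul, map_sum]
  have (a : Fˣ) : toInduced η v hv (single (a • h⁻¹ • (⟨v, hv⟩ : NV m F)) ((η a : ℂ)⁻¹)) =
      indMk (η.comp (eigenvalue v hv)) h := by
    rw [← mul_one ((η a : ℂ)⁻¹), ← smul_eq_mul, ← MonoidAlgebra.smul_single, map_smul,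
      toInduced_single η (h := h⁻¹) (b := a) rfl, inv_inv, inv_smul_smul₀ (η a).ne_zero]
  simp only [this, Finset.sum_const, Finset.card_univ]
  rw [← Nat.cast_smul_eq_nsmul ℂ, inv_smul_smul₀ card_units_ne_zero]

/-- The characters of the induced representations. -/
lemma character_inducedRep (v : V m F) (hv : v ≠ 0) :
    (inducedRep (η.comp (eigenvalue v hv))).character = theta m η := by
  ext g
  have h1 : inducedRep (η.comp (eigenvalue v hv)) g = toInduced η v hv ∘ₗ
      (permModule (Sp m F) (NV m F) g ∘ₗ (ofInduced η v hv).toLinearMap) := by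
    rw [← (ofInduced η v hv).isIntertwining', ← LinearMap.comp_assoc, toInduced_comp_ofInduced,
      LinearMap.id_comp]
  have h2 (u : NV m F) : (ofInduced η v hv) (toInduced η v hv (single u 1)) =
      semiInvariant η u := by
    obtain ⟨k, hk⟩ := NV.exists_smul_eq ⟨v, hv⟩ u
    rw [toInduced_single η (h := k) (b := 1) (by rw [← hk, one_smul]; rfl)]
    simp [ofInduced_indMk, hk]
  -- Cyclicity of the trace moves the computation to the basis of nonzero vectors, where `ofInduced`
  -- after `toInduced` is the projection u ↦ `semiInvariant η u`.
  rw [character, h1, LinearMap.trace_comp_comm', trace_monoidAlgebra, theta]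
  have h3 (u : NV m F) : ((permModule (Sp m F) (NV m F) g ∘ₗ (ofInduced η v hv).toLinearMap ∘ₗ
      toInduced η v hv) (single u 1)).coeff u =
        (Fintype.card Fˣ : ℂ)⁻¹ * ∑ a : Fˣ, (η a : ℂ) * if g • u = a • u then 1 else 0 := by
    rw [LinearMap.comp_apply, LinearMap.comp_apply, IntertwiningMap.toLinearMap_apply, h2,
      smul_semiInvariant, semiInvariant]
    simp only [coeff_smul, Finsupp.smul_apply, smul_eq_mul, coeff_sum, Finsupp.finsetSum_apply,
      coeff_single, Finsupp.single_apply]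
    congr 1
    refine Fintype.sum_equiv (Equiv.inv _) _ _ fun a ↦ ?_
    simp only [Equiv.inv_apply, map_inv, Units.val_inv_eq_inv_val, eq_inv_smul_iff, mul_ite,
      mul_one, mul_zero]
  rw [LinearMap.comp_assoc, Finset.sum_congr rfl fun u _ ↦ h3 u, ← Finset.mul_sum, Finset.sum_comm]
  simp only [eigenCount, Finset.mul_sum]

variable [CharP F 2]

/-- The character `η` of the square root, extended by zero. -/
def sqrtChar (c : F) : ℂ := if h : c = 0 then 0 else η (Units.mk0 (sqrtF F c) (by simpa using h))

/-- As Q(av) = a²Q(v), the square root turns the scaling of v into the factor η(a). -/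
lemma sqrtChar_mul (a : Fˣ) (c : F) : sqrtChar η ((a : F) * a * c) = η a * sqrtChar η c := by
  by_cases hc : c = 0
  · simp [hc, sqrtChar]
  · rw [sqrtChar, sqrtChar, dif_neg hc, dif_neg (mul_ne_zero (mul_ne_zero a.ne_zero a.ne_zero) hc),
      ← Units.val_mul (η a), ← map_mul η]
    congr 2
    ext
    simp [← sq, sqrtF_pow_two]

/-- Every induced character occurs in the permutation characters on forms. -/
lemma charInner_cosets_theta_ne_zero (hm : 1 ≤ m) (Q : Forms m F) :
    charInner (permChar (Sp m F) (Sp m F ⧸ orthogonalSubgroup Q.1)) (theta m η) ≠ 0 := by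
  let v : V m F := Pi.single (.inl ⟨0, hm⟩) 1
  have hv : v ≠ 0 := fun h ↦ by simpa [v] using congrFun h (.inl ⟨0, hm⟩)
  have := Fintype.ofFinite (Sp m F ⧸ orthogonalSubgroup Q.1)
  -- By Frobenius reciprocity, a nonzero vector on which P acts through η gives a nonzero map from
  -- the induced module.
  let y : MonoidAlgebra ℂ (Sp m F ⧸ orthogonalSubgroup Q.1) :=
    ∑ c, single c (sqrtChar η ((Q.ofCoset c).1 v))
  have hy (p : parabolic v hv) : permModule (Sp m F) (Sp m F ⧸ orthogonalSubgroup Q.1) p y =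
      ((η.comp (eigenvalue v hv)) p : ℂ) • y := by
    simp only [y, map_sum, ofMulAction_single, Finset.smul_sum, MonoidAlgebra.smul_single]
    refine Fintype.sum_equiv (MulAction.toPerm (p : Sp m F)) _ _ fun c ↦ ?_
    simp only [MulAction.toPerm_apply]
    rw [Q.ofCoset_smul, Forms.smul_apply]
    have : (p : Sp m F)⁻¹ • v = ((eigenvalue v hv p)⁻¹ : Fˣ) • v := by
      rw [inv_smul_eq_iff]
      have h1 : (p : Sp m F) • ((eigenvalue v hv p)⁻¹ : Fˣ) • v =
        ((eigenvalue v hv p)⁻¹ : Fˣ) • (p : Sp m F) • v :=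
        smul_comm _ (((eigenvalue v hv p)⁻¹ : Fˣ) : F) v
      rw [h1, ← eigenvalue_smul, inv_smul_smul]
    rw [this, Units.smul_def, QuadraticMap.map_smul, smul_eq_mul, smul_eq_mul, sqrtChar_mul,
      MonoidHom.comp_apply, map_inv, Units.val_inv_eq_inv_val, mul_inv_cancel_left₀ (Units.ne_zero _)]
  rw [← character_inducedRep η v hv, permChar, charInner_character, Nat.cast_ne_zero]
  have hne : indLift hy ≠ 0 := by
    intro h0
    have h1 := indLift_indMk hy 1
    rw [h0, inv_one, map_one] at h1
    -- The coset of k⁻¹ corresponds to the form with value Q(kv) ≠ 0 at v, so the coefficient of `y`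
    -- there is a value of η and not 0.
    obtain ⟨k, hk⟩ := Q.exists_ne_zero hv
    have h2 := congrArg (fun z ↦ z.coeff ((k⁻¹ : Sp m F) : Sp m F ⧸ orthogonalSubgroup Q.1)) h1
    have h3 : (Q.ofCoset ((k⁻¹ : Sp m F) : Sp m F ⧸ orthogonalSubgroup Q.1)).1 v = Q.1 (k • v) := by
      change (k⁻¹ • Q).1 v = _
      rw [Forms.smul_apply, inv_inv]
    simp [y, Finsupp.single_apply, h3, sqrtChar, hk] at h2
    exact (Units.ne_zero _) h2.symm
  have : Nontrivial (IntertwiningMap (inducedRep (η.comp (eigenvalue v hv)))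
      (permModule (Sp m F) (Sp m F ⧸ orthogonalSubgroup Q.1))) := ⟨_, _, hne⟩
  exact Module.finrank_pos.ne'

end Parabolic

/-! ### Representatives up to inversion -/

section Halves

open scoped Classical

variable {A : Type*} [CommGroup A] [Fintype A]

/-- A set of representatives of the nontrivial elements of `A` up to inversion, when `A` has no
involutions. -/
structure IsHalf (S : Finset A) : Prop where
  one_notMem : 1 ∉ S
  mem_iff : ∀ a, a ≠ 1 → (a ∈ S ↔ a⁻¹ ∉ S)

/-- Any enumeration of A selects the smaller of a and a⁻¹; these differ for a ≠ 1 since there are no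
involutions. -/
lemma exists_isHalf (hA : ∀ a : A, a * a = 1 → a = 1) : ∃ S : Finset A, IsHalf S := by
  let e := Fintype.equivFin A
  refine ⟨Finset.univ.filter fun a ↦ e a < e a⁻¹, by simp, fun a ha ↦ ?_⟩
  have hne : e a ≠ e a⁻¹ := fun h ↦ ha (hA a (mul_eq_one_iff_eq_inv.2 (e.injective h)))
  simp only [Finset.mem_filter, Finset.mem_univ, true_and, inv_inv, not_lt]
  exact ⟨le_of_lt, fun h ↦ lt_of_le_of_ne h hne⟩

lemma IsHalf.sum_eq {M : Type*} [AddCommMonoid M] {S : Finset A} (hS : IsHalf S) (f : A → M) :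
    ∑ a, f a = f 1 + (∑ a ∈ S, f a + ∑ a ∈ S, f a⁻¹) := by
  have hdisj : Disjoint S (S.image (·⁻¹)) := by
    rw [Finset.disjoint_left]
    intro a ha ha'
    obtain ⟨b, hb, rfl⟩ := Finset.mem_image.1 ha'
    have hb1 : b ≠ 1 := fun h ↦ hS.one_notMem (h ▸ hb)
    exact (hS.mem_iff b hb1).1 hb ha
  have hun : Finset.univ.erase 1 = S ∪ S.image (·⁻¹) := by
    ext a
    simp only [Finset.mem_erase, Finset.mem_univ, and_true, Finset.mem_union, Finset.mem_image]
    constructor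
    · intro ha
      by_cases h : a ∈ S
      · exact .inl h
      · refine .inr ⟨a⁻¹, ?_, inv_inv a⟩
        by_contra h'
        exact h ((hS.mem_iff a ha).2 h')
    · rintro (h | ⟨b, hb, rfl⟩)
      · exact fun h1 ↦ hS.one_notMem (h1 ▸ h)
      · exact fun h1 ↦ hS.one_notMem (inv_eq_one.1 h1 ▸ hb)
  rw [← Finset.add_sum_erase Finset.univ f (Finset.mem_univ 1), hun, Finset.sum_union hdisj,
    Finset.sum_image fun a _ b _ h ↦ inv_injective h]

lemma IsHalf.card_eq {S : Finset A} (hS : IsHalf S) : Fintype.card A = 1 + (S.card + S.card) := by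
  simpa using hS.sum_eq (fun _ ↦ (1 : ℕ))

end Halves

/-! ### The trivial character and characters of norm three -/

section TrivialCharacter

open Representation

variable {G : Type*} [Group G]

lemma character_trivial : (trivial ℂ G ℂ).character = 1 := by
  ext g
  simp [character]

lemma charInner_one_one [Fintype G] : charInner (1 : G → ℂ) 1 = 1 := by
  simp [charInner]

lemma isIrreducibleCharacter_one [Fintype G] : IsIrreducibleCharacter (1 : G → ℂ) := by
  rw [← character_trivial]
  refine isIrreducibleCharacter_of_isIrreducible (isIrreducible_of_charInner_eq_one ?_)
  rw [character_trivial, charInner_one_one]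

open scoped Classical in
/-- A multiset of irreducible characters whose sum has norm three has no repetitions. -/
lemma nodup_of_charInner_eq_three [Fintype G] {M : Multiset (G → ℂ)}
    (hM : ∀ a ∈ M, IsIrreducibleCharacter a) (h : charInner M.sum M.sum = 3) :
    M.Nodup ∧ M.card = 3 := by
  have h3 : (M.map fun b ↦ M.count b).sum = 3 := by
    have := charInner_multiset_sum hM hM
    rw [h] at this
    exact_mod_cast this.symm
  have hnd : M.Nodup := by
    rw [Multiset.nodup_iff_count_le_one]
    intro a
    by_cases ha : a ∈ M
    · rw [Finset.sum_multiset_map_count] at h3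
      have := Finset.single_le_sum (f := fun b ↦ M.count b • M.count b) (fun _ _ ↦ Nat.zero_le _)
        (Multiset.mem_toFinset.2 ha)
      rw [h3] at this
      simp only [smul_eq_mul] at this
      nlinarith
    · simp [ha]
  refine ⟨hnd, ?_⟩
  rw [Multiset.map_congr rfl fun b hb ↦ Multiset.count_eq_one_of_mem hnd hb] at h3
  simpa using h3

lemma mem_of_charInner_ne_zero [Fintype G] {M : Multiset (G → ℂ)}
    (hM : ∀ a ∈ M, IsIrreducibleCharacter a) {b : G → ℂ} (hb : IsIrreducibleCharacter b)
    (h : charInner M.sum b ≠ 0) : b ∈ M := by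
  classical
  rw [charInner_multiset_sum_left hM hb, Nat.cast_ne_zero] at h
  exact Multiset.count_ne_zero.1 h

end TrivialCharacter

/-! ### Constituents of the permutation characters -/

section Decomposition

open Representation
open scoped Classical

variable {m : ℕ} {F : Type*} [Field F] [Fintype F]

lemma Forms.charInner_cosets_one (Q : Forms m F) :
    charInner (permChar (Sp m F) (Sp m F ⧸ orthogonalSubgroup Q.1)) 1 = 1 := by
  rw [charInner_permChar_one]
  have := (MulAction.pretransitive_iff_subsingleton_quotient (Sp m F)
    (Sp m F ⧸ orthogonalSubgroup Q.1)).1 inferInstance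
  have : Nonempty (MulAction.orbitRel.Quotient (Sp m F) (Sp m F ⧸ orthogonalSubgroup Q.1)) :=
    ⟨Quotient.mk'' ((1 : Sp m F) : Sp m F ⧸ orthogonalSubgroup Q.1)⟩
  rw [Nat.card_eq_one_iff_unique.2 ⟨inferInstance, inferInstance⟩, Nat.cast_one]

/-- The inner product counts orbits on pairs (coset, point). Over the base coset, a singular and a
nonsingular point are inequivalent, as g fixing that coset is an isometry of Q. -/
lemma Forms.exists_charInner_cosets_proj (Q : Forms m F)
    (hQ : ∃ W, IsTotallySingular Q.1 W ∧ 0 < Module.finrank F W) :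
    ∃ n : ℕ, 2 ≤ n ∧ charInner (permChar (Sp m F) (Sp m F ⧸ orthogonalSubgroup Q.1))
      (theta m 1) = n := by
  rw [← permChar_proj, charInner_permChar]
  refine ⟨_, ?_, rfl⟩
  obtain ⟨W, hW, hpos⟩ := hQ
  rw [Module.finrank_pos_iff, Submodule.nontrivial_iff_ne_bot] at hpos
  obtain ⟨u, huW, hu⟩ := Submodule.exists_mem_ne_zero_of_ne_bot hpos
  obtain ⟨k, hk⟩ := Q.exists_ne_zero hu
  have hku : k • u ≠ 0 := (smul_ne_zero_iff_ne k).2 hu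
  let o : Sp m F ⧸ orthogonalSubgroup Q.1 := (1 : Sp m F)
  have hne : (Quotient.mk'' (o, Projectivization.mk F u hu) :
      MulAction.orbitRel.Quotient (Sp m F) ((Sp m F ⧸ orthogonalSubgroup Q.1) × ℙ F (V m F))) ≠
      Quotient.mk'' (o, Projectivization.mk F (k • u) hku) := by
    intro h
    rw [Quotient.eq'', MulAction.orbitRel_apply] at h
    obtain ⟨g, hg⟩ := h
    simp only [Prod.smul_mk, Prod.mk_inj] at hg
    have hgO : g ∈ orthogonalSubgroup Q.1 := by
      have h1 : ((g * 1 : Sp m F) : Sp m F ⧸ orthogonalSubgroup Q.1) = (1 : Sp m F) := hg.1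
      rw [mul_one, QuotientGroup.eq, mul_one, inv_mem_iff] at h1
      exact h1
    have h2 := hg.2
    rw [Projectivization.smul_mk, Projectivization.mk_eq_mk_iff'] at h2
    obtain ⟨a, ha⟩ := h2
    refine hk ?_
    rw [← hgO, ← ha, QuadraticMap.map_smul, hW u huW, smul_zero]
  have : Nontrivial (MulAction.orbitRel.Quotient (Sp m F)
    ((Sp m F ⧸ orthogonalSubgroup Q.1) × ℙ F (V m F))) := ⟨_, _, hne⟩
  exact Finite.one_lt_card

/-- The permutation character on points has three distinct constituents. -/
lemma exists_constituents_proj (hm : 2 ≤ m) : ∃ χ₁ χ₂ : Sp m F → ℂ,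
    IsIrreducibleCharacter χ₁ ∧ IsIrreducibleCharacter χ₂ ∧
      ({1, χ₁, χ₂} : Multiset (Sp m F → ℂ)).Nodup ∧ theta m (1 : Fˣ →* ℂˣ) = 1 + χ₁ + χ₂ := by
  obtain ⟨M, hM, hMs⟩ := exists_multiset_irreducible (permModule (Sp m F) (ℙ F (V m F)))
  have hMs' : M.sum = theta m (1 : Fˣ →* ℂˣ) := hMs.trans permChar_proj
  obtain ⟨hnd, hcard⟩ := nodup_of_charInner_eq_three hM (by
    rw [hMs', charInner_theta hm, if_pos rfl, if_pos ⟨rfl, rfl⟩, if_pos (by ext; simp)]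
    norm_num)
  have h1 : 1 ∈ M := by
    refine mem_of_charInner_ne_zero hM isIrreducibleCharacter_one ?_
    rw [hMs, charInner_permChar_one, Nat.cast_ne_zero]
    let v : V m F := Pi.single (.inl ⟨0, by omega⟩) 1
    have hv : v ≠ 0 := fun h ↦ by simpa [v] using congrFun h (.inl ⟨0, by omega⟩)
    have : Nonempty (MulAction.orbitRel.Quotient (Sp m F) (ℙ F (V m F))) :=
      ⟨Quotient.mk'' (Projectivization.mk F v hv)⟩
    exact Nat.card_pos.ne'
  obtain ⟨N, rfl⟩ := Multiset.exists_cons_of_mem h1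
  rw [Multiset.card_cons] at hcard
  obtain ⟨χ₁, χ₂, rfl⟩ := Multiset.card_eq_two.1 (show N.card = 2 by omega)
  refine ⟨χ₁, χ₂, hM _ (by simp), hM _ (by simp), hnd, ?_⟩
  rw [← hMs']
  simp [add_assoc]

variable [CharP F 2]

/-- Every element of Fˣ is a square in characteristic two, so a character with trivial square is
trivial. -/
lemma character_eq_one_of_mul_self {η : Fˣ →* ℂˣ} (h : η * η = 1) : η = 1 := by
  refine MonoidHom.ext fun a ↦ ?_
  let b : Fˣ := Units.mk0 (sqrtF F a) (by simp)
  have hb : a = b * b := by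
    ext
    simp [b, ← sq, sqrtF_sq]
  rw [hb, map_mul]
  exact DFunLike.congr_fun h b

lemma inducedRep_isIrreducible (hm : 2 ≤ m) {η : Fˣ →* ℂˣ} (hη : η ≠ 1) (v : V m F) (hv : v ≠ 0) :
    (inducedRep (η.comp (eigenvalue v hv))).IsIrreducible := by
  refine isIrreducible_of_charInner_eq_one ?_
  rw [character_inducedRep, charInner_theta hm, if_pos rfl, if_neg (by simp [hη]),
    if_neg fun h ↦ hη (character_eq_one_of_mul_self h)]
  simp

lemma isIrreducibleCharacter_theta (hm : 2 ≤ m) {η : Fˣ →* ℂˣ} (hη : η ≠ 1) :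
    IsIrreducibleCharacter (theta m η) := by
  let v : V m F := Pi.single (.inl ⟨0, by omega⟩) 1
  have hv : v ≠ 0 := fun h ↦ by simpa [v] using congrFun h (.inl ⟨0, by omega⟩)
  rw [← character_inducedRep η v hv]
  exact isIrreducibleCharacter_of_isIrreducible (inducedRep_isIrreducible hm hη v hv)

lemma theta_eq_iff (hm : 2 ≤ m) {η ξ : Fˣ →* ℂˣ} (hη : η ≠ 1) (hξ : ξ ≠ 1) :
    theta m η = theta m ξ ↔ η = ξ ∨ η * ξ = 1 := by
  have h := charInner_irreducible (isIrreducibleCharacter_theta hm hη)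
    (isIrreducibleCharacter_theta hm hξ)
  rw [charInner_theta hm, if_neg (c := η = 1 ∧ ξ = 1) (by simp [hη])] at h
  split_ifs at h with h1 h2 h3 h4 <;> simp_all

lemma theta_inv_eq (hm : 2 ≤ m) {η : Fˣ →* ℂˣ} (hη : η ≠ 1) : theta m η⁻¹ = theta m η := by
  have hη' : η⁻¹ ≠ 1 := fun h ↦ hη (by
    rw [← inv_inv η, h]
    ext; simp)
  rw [theta_eq_iff hm hη' hη]
  right
  ext; simp

/-- For η ≠ 1 the characters θ_1 and θ_η are orthogonal, so they share no constituent. -/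
lemma theta_ne_constituent (hm : 2 ≤ m) {χ₁ χ₂ : Sp m F → ℂ} (h₁ : IsIrreducibleCharacter χ₁)
    (h₂ : IsIrreducibleCharacter χ₂) (hθ : theta m (1 : Fˣ →* ℂˣ) = 1 + χ₁ + χ₂)
    {η : Fˣ →* ℂˣ} (hη : η ≠ 1) :
    theta m η ∉ ({1, χ₁, χ₂} : Multiset (Sp m F → ℂ)) := by
  intro h
  have hM : ∀ a ∈ ({1, χ₁, χ₂} : Multiset (Sp m F → ℂ)), IsIrreducibleCharacter a := by
    intro a ha
    simp only [Multiset.insert_eq_cons, Multiset.mem_cons, Multiset.mem_singleton] at ha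
    rcases ha with rfl | rfl | rfl
    exacts [isIrreducibleCharacter_one, h₁, h₂]
  have hc := charInner_multiset_sum_left hM (isIrreducibleCharacter_theta hm hη)
  have hs : ({1, χ₁, χ₂} : Multiset (Sp m F → ℂ)).sum = theta m (1 : Fˣ →* ℂˣ) := by
    rw [hθ]; simp [add_assoc]
  rw [hs, charInner_theta hm, if_neg (Ne.symm hη), if_neg (by simp [hη]),
    if_neg fun h ↦ hη (by rw [← h]; ext; simp)] at hc
  have : Multiset.count (theta m η) ({1, χ₁, χ₂} : Multiset (Sp m F → ℂ)) = 0 := by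
    have : (0 : ℂ) = (Multiset.count (theta m η) ({1, χ₁, χ₂} : Multiset (Sp m F → ℂ)) : ℂ) := by
      rw [← hc]; simp
    exact_mod_cast this.symm
  exact Multiset.count_eq_zero.1 this h

lemma permChar_vectors_eq_half (hm : 2 ≤ m) {S : Finset (Fˣ →* ℂˣ)} (hS : IsHalf S) :
    permChar (Sp m F) (V m F) =
      1 + theta m 1 + (∑ η ∈ S, theta m η + ∑ η ∈ S, theta m η) := by
  rw [permChar_vectors_eq_sum, hS.sum_eq, add_assoc, Finset.sum_congr (g := fun η ↦ theta m η) rfl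
    fun η hη ↦ theta_inv_eq hm fun h ↦ hS.one_notMem (h ▸ hη)]

/-- Two characters adding up to the permutation character on vectors are determined by a few of
their constituents. -/
lemma eq_of_constituents (hm : 2 ≤ m) {χ₁ χ₂ : Sp m F → ℂ} (h₁ : IsIrreducibleCharacter χ₁)
    (h₂ : IsIrreducibleCharacter χ₂) (hnd : ({1, χ₁, χ₂} : Multiset (Sp m F → ℂ)).Nodup)
    (hθ : theta m (1 : Fˣ →* ℂˣ) = 1 + χ₁ + χ₂) {S : Finset (Fˣ →* ℂˣ)} (hS : IsHalf S)
    {M₁ M₂ : Multiset (Sp m F → ℂ)} (hM₁ : ∀ a ∈ M₁, IsIrreducibleCharacter a)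
    (hM₂ : ∀ a ∈ M₂, IsIrreducibleCharacter a)
    (hsum : permChar (Sp m F) (V m F) = M₁.sum + M₂.sum)
    (hone₁ : 1 ∈ M₁) (hone₂ : 1 ∈ M₂) (hχ₁ : χ₁ ∈ M₁) (hχ₂ : χ₂ ∈ M₂)
    (hθ₁ : ∀ η ∈ S, theta m η ∈ M₁) (hθ₂ : ∀ η ∈ S, theta m η ∈ M₂) :
    M₁.sum = 1 + χ₁ + ∑ η ∈ S, theta m η ∧ M₂.sum = 1 + χ₂ + ∑ η ∈ S, theta m η := by
  have hne {η : Fˣ →* ℂˣ} (hη : η ∈ S) : η ≠ 1 := fun h ↦ hS.one_notMem (h ▸ hη)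
  let T : Multiset (Sp m F → ℂ) := S.val.map (theta m)
  have hT : T.sum = ∑ η ∈ S, theta m η := rfl
  have hTmem {a : Sp m F → ℂ} (ha : a ∈ T) : ∃ η ∈ S, theta m η = a := Multiset.mem_map.1 ha
  have hTnd : T.Nodup := by
    refine Multiset.Nodup.map_on (fun η hη ξ hξ h ↦ ?_) S.nodup
    rcases (theta_eq_iff hm (hne hη) (hne hξ)).1 h with h | h
    · exact h
    · have hinv : η⁻¹ = ξ := by
        rw [← mul_one η⁻¹, ← h]
        ext; simp
      exact absurd (hinv ▸ hξ) ((hS.mem_iff η (hne hη)).1 hη)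
  have hTχ {a : Sp m F → ℂ} (ha : a ∈ T) : a ∉ ({1, χ₁, χ₂} : Multiset (Sp m F → ℂ)) := by
    obtain ⟨η, hη, rfl⟩ := hTmem ha
    exact theta_ne_constituent hm h₁ h₂ hθ (hne hη)
  simp only [Multiset.insert_eq_cons, Multiset.mem_cons, Multiset.mem_singleton, not_or,
    Multiset.nodup_cons, Multiset.nodup_singleton, and_true] at hnd hTχ
  have hT1 : (1 : Sp m F → ℂ) ∉ T := fun h ↦ (hTχ h).1 rfl
  have hTχ₁ : χ₁ ∉ T := fun h ↦ (hTχ h).2.1 rfl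
  have hTχ₂ : χ₂ ∉ T := fun h ↦ (hTχ h).2.2 rfl
  have hle₁ : 1 ::ₘ χ₁ ::ₘ T ≤ M₁ := by
    rw [Multiset.le_iff_subset (by simp [hTnd, hTχ₁, hT1, hnd.1.1])]
    intro a ha
    simp only [Multiset.mem_cons] at ha
    rcases ha with rfl | rfl | ha
    · exact hone₁
    · exact hχ₁
    · obtain ⟨η, hη, rfl⟩ := hTmem ha
      exact hθ₁ η hη
  have hle₂ : 1 ::ₘ χ₂ ::ₘ T ≤ M₂ := by
    rw [Multiset.le_iff_subset (by simp [hTnd, hTχ₂, hT1, hnd.1.2])]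
    intro a ha
    simp only [Multiset.mem_cons] at ha
    rcases ha with rfl | rfl | ha
    · exact hone₂
    · exact hχ₂
    · obtain ⟨η, hη, rfl⟩ := hTmem ha
      exact hθ₂ η hη
  -- The two lower bounds already add up to π, so the multisets agree and the remainders `U₁`, `U₂`
  -- below are empty.
  have heq : M₁ + M₂ = (1 ::ₘ χ₁ ::ₘ T) + (1 ::ₘ χ₂ ::ₘ T) := by
    refine multiset_eq_of_sum_eq (fun a ha ↦ (Multiset.mem_add.1 ha).elim (hM₁ a) (hM₂ a))
      (fun a ha ↦ (Multiset.mem_add.1 ha).elim (fun h ↦ hM₁ a (Multiset.mem_of_le hle₁ h))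
        fun h ↦ hM₂ a (Multiset.mem_of_le hle₂ h)) ?_
    rw [Multiset.sum_add, ← hsum, permChar_vectors_eq_half hm hS, hθ]
    simp only [Multiset.sum_add, Multiset.sum_cons, hT]
    ring
  obtain ⟨U₁, rfl⟩ := Multiset.le_iff_exists_add.1 hle₁
  obtain ⟨U₂, rfl⟩ := Multiset.le_iff_exists_add.1 hle₂
  have hcard := congrArg Multiset.card heq
  simp only [Multiset.card_add] at hcard
  have hU₁ : U₁ = 0 := Multiset.card_eq_zero.1 (by omega)
  have hU₂ : U₂ = 0 := Multiset.card_eq_zero.1 (by omega)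
  subst hU₁ hU₂
  simp [hT, add_assoc]

end Decomposition

/-! ### Splitting the constituents between the two coset spaces -/

section Main

open Representation
open scoped Classical

variable {m : ℕ} {F : Type*} [Field F] [Fintype F]

/-- A character with nonzero trivial part and at least two common constituents with the
permutation character on points contains a nontrivial constituent of the latter. -/
lemma mem_or_mem_of_cosets {Q : Forms m F} {χ₁ χ₂ : Sp m F → ℂ}
    (h₁ : IsIrreducibleCharacter χ₁) (h₂ : IsIrreducibleCharacter χ₂)
    (hθ : theta m (1 : Fˣ →* ℂˣ) = 1 + χ₁ + χ₂)
    (hQ : ∃ W, IsTotallySingular Q.1 W ∧ 0 < Module.finrank F W) {M : Multiset (Sp m F → ℂ)}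
    (hM : ∀ a ∈ M, IsIrreducibleCharacter a)
    (hMs : M.sum = permChar (Sp m F) (Sp m F ⧸ orthogonalSubgroup Q.1)) : χ₁ ∈ M ∨ χ₂ ∈ M := by
  obtain ⟨n, hn, h⟩ := Q.exists_charInner_cosets_proj hQ
  by_contra! hmem
  rw [hθ, charInner_add_right, charInner_add_right, Q.charInner_cosets_one, ← hMs,
    charInner_multiset_sum_left hM h₁, charInner_multiset_sum_left hM h₂,
    Multiset.count_eq_zero.2 hmem.1, Multiset.count_eq_zero.2 hmem.2] at h
  have : 1 = n := by
    have h' : ((1 : ℕ) : ℂ) = n := by rw [← h]; simp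
    exact_mod_cast h'
  omega

lemma image_filter_eq {v : V m F} {hv : v ≠ 0} {S : Finset (parabolic v hv →* ℂˣ)}
    (hS : IsConjRepresentatives S) :
    (Finset.univ.filter fun η : Fˣ →* ℂˣ ↦ η.comp (eigenvalue v hv) ∈ S).image
      (·.comp (eigenvalue v hv)) = S := by
  ext ζ
  simp only [Finset.mem_image, Finset.mem_filter, Finset.mem_univ, true_and]
  constructor
  · rintro ⟨η, hη, rfl⟩
    exact hη
  · intro hζ
    obtain ⟨η, -, rfl⟩ := isNontrivialModStabilizer_iff.1 (hS.1 ζ hζ)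
    exact ⟨η, hζ, rfl⟩

variable [CharP F 2]

/-- The restriction of a set of representatives to characters of the multiplicative group. -/
lemma isHalf_of_isConjRepresentatives {v : V m F} {hv : v ≠ 0}
    {S : Finset (parabolic v hv →* ℂˣ)} (hS : IsConjRepresentatives S) :
    IsHalf (Finset.univ.filter fun η : Fˣ →* ℂˣ ↦ η.comp (eigenvalue v hv) ∈ S) := by
  constructor
  · simp only [Finset.mem_filter, Finset.mem_univ, true_and, MonoidHom.one_comp]
    exact fun h ↦ (hS.1 _ h).1 rfl
  · intro η hη
    simp only [Finset.mem_filter, Finset.mem_univ, true_and]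
    -- Because η and η⁻¹ are distinct, uniqueness of the representative says that exactly one of
    -- them is chosen.
    have hne : η ≠ η⁻¹ := fun h ↦ hη (character_eq_one_of_mul_self (by
      nth_rw 2 [h]
      ext; simp))
    obtain ⟨ξ, ⟨hξS, hξ⟩, huniq⟩ := hS.2 _ (isNontrivialModStabilizer_iff.2 ⟨η, hη, rfl⟩)
    rw [conjChar_comp_eigenvalue] at hξ huniq
    constructor
    · intro h h'
      exact hne (comp_eigenvalue_injective
        ((huniq _ ⟨h, .inl rfl⟩).trans (huniq _ ⟨h', .inr rfl⟩).symm))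
    · intro h
      rcases hξ with rfl | rfl
      · exact hξS
      · exact absurd hξS h

lemma exists_isConjRepresentatives (v : V m F) (hv : v ≠ 0) :
    ∃ S : Finset (parabolic v hv →* ℂˣ), IsConjRepresentatives S := by
  obtain ⟨S, hS⟩ := exists_isHalf (A := Fˣ →* ℂˣ) fun η h ↦ character_eq_one_of_mul_self h
  have hmem {η : Fˣ →* ℂˣ} : η.comp (eigenvalue v hv) ∈ S.image (·.comp (eigenvalue v hv)) ↔
      η ∈ S := by
    rw [Finset.mem_image]
    exact ⟨fun ⟨ξ, hξ, h⟩ ↦ comp_eigenvalue_injective h ▸ hξ, fun h ↦ ⟨η, h, rfl⟩⟩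
  refine ⟨S.image (·.comp (eigenvalue v hv)), fun ζ hζ ↦ ?_, fun ζ hζ ↦ ?_⟩
  · obtain ⟨η, hη, rfl⟩ := Finset.mem_image.1 hζ
    exact isNontrivialModStabilizer_iff.2 ⟨η, fun h ↦ hS.one_notMem (h ▸ hη), rfl⟩
  · obtain ⟨η, hη, rfl⟩ := isNontrivialModStabilizer_iff.1 hζ
    rw [conjChar_comp_eigenvalue]
    have hiff : η ∈ S ↔ η⁻¹ ∉ S := hS.mem_iff η hη
    by_cases h : η ∈ S
    · refine ⟨_, ⟨hmem.2 h, .inl rfl⟩, ?_⟩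
      rintro _ ⟨h', rfl | rfl⟩
      · rfl
      · exact absurd (hmem.1 h') (hiff.1 h)
    · have h2 : η⁻¹ ∈ S := by
        by_contra h2
        exact h (hiff.2 h2)
      refine ⟨_, ⟨hmem.2 h2, .inr rfl⟩, ?_⟩
      rintro _ ⟨h', rfl | rfl⟩
      · exact absurd (hmem.1 h') h
      · rfl

/-- The decomposition of the permutation characters of the two coset spaces. -/
lemma exists_decomposition (hm : 2 ≤ m) {Qp Qm : Forms m F} (hp : IsPlusType Qp.1)
    (hmi : IsMinusType Qm.1) : ∃ χp χm : Sp m F → ℂ,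
      IsIrreducibleCharacter χp ∧ IsIrreducibleCharacter χm ∧ χp ≠ 1 ∧ χm ≠ 1 ∧ χp ≠ χm ∧
      theta m (1 : Fˣ →* ℂˣ) = 1 + χp + χm ∧ ∀ S : Finset (Fˣ →* ℂˣ), IsHalf S →
        permChar (Sp m F) (Sp m F ⧸ orthogonalSubgroup Qp.1) = 1 + χp + ∑ η ∈ S, theta m η ∧
        permChar (Sp m F) (Sp m F ⧸ orthogonalSubgroup Qm.1) = 1 + χm + ∑ η ∈ S, theta m η := by
  obtain ⟨Mp, hMp, hMps⟩ := exists_multiset_irreducible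
    (permModule (Sp m F) (Sp m F ⧸ orthogonalSubgroup Qp.1))
  obtain ⟨Mm, hMm, hMms⟩ := exists_multiset_irreducible
    (permModule (Sp m F) (Sp m F ⧸ orthogonalSubgroup Qm.1))
  have hsum : permChar (Sp m F) (V m F) = Mp.sum + Mm.sum := by
    rw [hMps, hMms, permChar_vectors (Forms.notMem_orbit_of_type hp hmi)]
  have hWp : ∃ W, IsTotallySingular Qp.1 W ∧ 0 < Module.finrank F W := by
    obtain ⟨W, hW, h⟩ := hp.exists_singular
    exact ⟨W, hW, by omega⟩
  -- The Witt index m − 1 is positive because m ≥ 2.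
  have hWm : ∃ W, IsTotallySingular Qm.1 W ∧ 0 < Module.finrank F W := by
    obtain ⟨W, hW, h⟩ := hmi.exists_singular
    exact ⟨W, hW, by omega⟩
  have hone {Q : Forms m F} {M : Multiset (Sp m F → ℂ)} (hM : ∀ a ∈ M, IsIrreducibleCharacter a)
      (hMs : M.sum = permChar (Sp m F) (Sp m F ⧸ orthogonalSubgroup Q.1)) : 1 ∈ M :=
    mem_of_charInner_ne_zero hM isIrreducibleCharacter_one (by
      rw [hMs, Q.charInner_cosets_one]; exact one_ne_zero)
  have hmemθ {Q : Forms m F} {M : Multiset (Sp m F → ℂ)} (hM : ∀ a ∈ M, IsIrreducibleCharacter a)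
      (hMs : M.sum = permChar (Sp m F) (Sp m F ⧸ orthogonalSubgroup Q.1)) {η : Fˣ →* ℂˣ}
      (hη : η ≠ 1) : theta m η ∈ M :=
    mem_of_charInner_ne_zero hM (isIrreducibleCharacter_theta hm hη) (by
      rw [hMs]; exact charInner_cosets_theta_ne_zero η (by omega) Q)
  obtain ⟨χ₁, χ₂, h₁, h₂, hnd, hθ⟩ := exists_constituents_proj (F := F) hm
  have hsplit : ∃ χp χm : Sp m F → ℂ, IsIrreducibleCharacter χp ∧ IsIrreducibleCharacter χm ∧
      ({1, χp, χm} : Multiset (Sp m F → ℂ)).Nodup ∧ theta m (1 : Fˣ →* ℂˣ) = 1 + χp + χm ∧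
      χp ∈ Mp ∧ χm ∈ Mm := by
    obtain ⟨S, hS⟩ := exists_isHalf (A := Fˣ →* ℂˣ) fun η h ↦ character_eq_one_of_mul_self h
    -- A nontrivial constituent of the character on points has multiplicity one in π, so it cannot
    -- occur on both sides; the two sides therefore take different ones.
    have hcount {χ χ' : Sp m F → ℂ} (h : IsIrreducibleCharacter χ) (h' : IsIrreducibleCharacter χ')
        (hnd : ({1, χ, χ'} : Multiset (Sp m F → ℂ)).Nodup)
        (hθ : theta m (1 : Fˣ →* ℂˣ) = 1 + χ + χ') (hχp : χ ∈ Mp) : χ ∉ Mm := by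
      intro hχm
      have hc : charInner (permChar (Sp m F) (V m F)) χ = 1 := by
        have hone' : charInner (1 : Sp m F → ℂ) χ = 0 := by
          rw [charInner_irreducible isIrreducibleCharacter_one h, if_neg]
          rintro rfl
          simp at hnd
        have hχ' : charInner χ' χ = 0 := by
          rw [charInner_irreducible h' h, if_neg]
          rintro rfl
          simp at hnd
        have hS' : charInner (∑ η ∈ S, theta m η) χ = 0 := by
          have hM : ∀ a ∈ S.val.map (theta m), IsIrreducibleCharacter a := by
            intro a ha
            obtain ⟨η, hη, rfl⟩ := Multiset.mem_map.1 ha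
            exact isIrreducibleCharacter_theta hm fun h ↦ hS.one_notMem (h ▸ hη)
          have := charInner_multiset_sum_left hM h
          rw [Multiset.count_eq_zero.2, Nat.cast_zero] at this
          · exact this
          · intro hmem
            obtain ⟨η, hη, hηχ⟩ := Multiset.mem_map.1 hmem
            exact theta_ne_constituent hm h h' hθ (fun h ↦ hS.one_notMem (h ▸ hη))
              (by simp [hηχ])
        rw [permChar_vectors_eq_half hm hS, hθ]
        simp only [charInner_add_left, hone', hχ', hS', charInner_irreducible h h, if_true]
        norm_num
      rw [hsum, charInner_add_left, charInner_multiset_sum_left hMp h,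
        charInner_multiset_sum_left hMm h] at hc
      have hc' : Mp.count χ + Mm.count χ = 1 := by exact_mod_cast hc
      have := Multiset.count_pos.2 hχp
      have := Multiset.count_pos.2 hχm
      omega
    have hnd' : ({1, χ₂, χ₁} : Multiset (Sp m F → ℂ)).Nodup := by
      rw [Multiset.pair_comm χ₂ χ₁]
      exact hnd
    have hθ' : theta m (1 : Fˣ →* ℂˣ) = 1 + χ₂ + χ₁ := by rw [hθ]; ring
    have hm' := mem_or_mem_of_cosets h₁ h₂ hθ hWm hMm hMms
    rcases mem_or_mem_of_cosets h₁ h₂ hθ hWp hMp hMps with h | h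
    · exact ⟨χ₁, χ₂, h₁, h₂, hnd, hθ, h, hm'.resolve_left (hcount h₁ h₂ hnd hθ h)⟩
    · exact ⟨χ₂, χ₁, h₂, h₁, hnd', hθ', h, hm'.resolve_right (hcount h₂ h₁ hnd' hθ' h)⟩
  obtain ⟨χp, χm, hχp, hχm, hnd, hθ, hpM, hmM⟩ := hsplit
  refine ⟨χp, χm, hχp, hχm, ?_, ?_, ?_, hθ, fun S hS ↦ ?_⟩
  · rintro rfl
    simp at hnd
  · rintro rfl
    simp at hnd
  · rintro rfl
    simp at hnd
  · have hne {η : Fˣ →* ℂˣ} (hη : η ∈ S) : η ≠ 1 := fun h ↦ hS.one_notMem (h ▸ hη)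
    have := eq_of_constituents hm hχp hχm hnd hθ hS hMp hMm hsum (hone hMp hMps) (hone hMm hMms)
      hpM hmM (fun η hη ↦ hmemθ hMp hMps (hne hη)) fun η hη ↦ hmemθ hMm hMms (hne hη)
    rwa [hMps, hMms] at this

end Main

end SpOrthogonal

end

/-! ### Assembly of the theorem -/

theorem theorem1 (F : Type*) [Field F] [Fintype F] [CharP F 2] (m : ℕ) (hm : 1 ≤ m)
    (Qp Qm : QuadraticForm F (SpOrthogonal.V m F))
    (hQp : SpOrthogonal.IsPlusType Qp) (hQm : SpOrthogonal.IsMinusType Qm) :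
    -- `ℂV ≅ ℂΩ⁺ ⊕ ℂΩ⁻`
    Nonempty ((SpOrthogonal.permModule (SpOrthogonal.Sp m F) (SpOrthogonal.V m F)).Equiv
      ((SpOrthogonal.permModule (SpOrthogonal.Sp m F)
          (SpOrthogonal.Sp m F ⧸ SpOrthogonal.orthogonalSubgroup Qp)).prod
        (SpOrthogonal.permModule (SpOrthogonal.Sp m F)
          (SpOrthogonal.Sp m F ⧸ SpOrthogonal.orthogonalSubgroup Qm)))) ∧
    -- `π = π⁺ + π⁻`
    SpOrthogonal.permChar (SpOrthogonal.Sp m F) (SpOrthogonal.V m F) =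
      SpOrthogonal.permChar (SpOrthogonal.Sp m F)
          (SpOrthogonal.Sp m F ⧸ SpOrthogonal.orthogonalSubgroup Qp) +
        SpOrthogonal.permChar (SpOrthogonal.Sp m F)
          (SpOrthogonal.Sp m F ⧸ SpOrthogonal.orthogonalSubgroup Qm) ∧
    -- the decompositions `π^± = 1 + χ^± + π'`
    (2 ≤ m → ∃ χp χm : SpOrthogonal.Sp m F → ℂ,
      SpOrthogonal.IsIrreducibleCharacter χp ∧ SpOrthogonal.IsIrreducibleCharacter χm ∧
      χp ≠ 1 ∧ χm ≠ 1 ∧ χp ≠ χm ∧ (χm 1).re < (χp 1).re ∧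
      SpOrthogonal.permChar (SpOrthogonal.Sp m F) (ℙ F (SpOrthogonal.V m F)) = 1 + χp + χm ∧
      ∀ (v : SpOrthogonal.V m F) (hv : v ≠ 0),
        (∃ S : Finset (SpOrthogonal.parabolic v hv →* ℂˣ),
          SpOrthogonal.IsConjRepresentatives S) ∧
        ∀ S : Finset (SpOrthogonal.parabolic v hv →* ℂˣ),
          SpOrthogonal.IsConjRepresentatives S →
          S.card = Fintype.card F / 2 - 1 ∧
          (∀ ζ ∈ S, (SpOrthogonal.inducedRep ζ).IsIrreducible) ∧
          Set.InjOn (fun ζ : SpOrthogonal.parabolic v hv →* ℂˣ =>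
            (SpOrthogonal.inducedRep ζ).character) (S : Set _) ∧
          SpOrthogonal.permChar (SpOrthogonal.Sp m F)
              (SpOrthogonal.Sp m F ⧸ SpOrthogonal.orthogonalSubgroup Qp) =
            1 + χp + ∑ ζ ∈ S, (SpOrthogonal.inducedRep ζ).character ∧
          SpOrthogonal.permChar (SpOrthogonal.Sp m F)
              (SpOrthogonal.Sp m F ⧸ SpOrthogonal.orthogonalSubgroup Qm) =
            1 + χm + ∑ ζ ∈ S, (SpOrthogonal.inducedRep ζ).character) := by
  classical
  obtain ⟨Rp, rfl⟩ : ∃ R : SpOrthogonal.Forms m F, R.1 = Qp := ⟨⟨Qp, hQp.polar_eq⟩, rfl⟩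
  obtain ⟨Rm, rfl⟩ : ∃ R : SpOrthogonal.Forms m F, R.1 = Qm := ⟨⟨Qm, hQm.polar_eq⟩, rfl⟩
  have hR : Rm ∉ MulAction.orbit (SpOrthogonal.Sp m F) Rp :=
    SpOrthogonal.Forms.notMem_orbit_of_type hQp hQm
  refine ⟨⟨SpOrthogonal.vectorsEquivCosets hR⟩, SpOrthogonal.permChar_vectors hR, fun hm2 ↦ ?_⟩
  obtain ⟨χp, χm, hp, hmi, hp1, hm1, hpm, hθ, hdec⟩ :=
    SpOrthogonal.exists_decomposition hm2 (Qp := Rp) (Qm := Rm) hQp hQm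
  refine ⟨χp, χm, hp, hmi, hp1, hm1, hpm, ?_, SpOrthogonal.permChar_proj.trans hθ, fun v hv ↦
    ⟨SpOrthogonal.exists_isConjRepresentatives v hv, fun S hS ↦ ?_⟩⟩
  -- At the identity the common part 1 + π' cancels, so χ⁺(1) − χ⁻(1) = |Ω⁺| − |Ω⁻| > 0.
  · obtain ⟨S, hS⟩ := SpOrthogonal.exists_isHalf (A := Fˣ →* ℂˣ)
      fun η h ↦ SpOrthogonal.character_eq_one_of_mul_self h
    obtain ⟨h₁, h₂⟩ := hdec S hS
    have hlt := SpOrthogonal.card_cosets_lt (Qp := Rp) (Qm := Rm) hQp hQm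
    have e₁ := congrFun h₁ 1
    have e₂ := congrFun h₂ 1
    rw [SpOrthogonal.permChar, Representation.char_one, SpOrthogonal.finrank_monoidAlgebra] at e₁ e₂
    have hcast : (Nat.card (SpOrthogonal.Sp m F ⧸ SpOrthogonal.orthogonalSubgroup Rm.1) : ℝ) <
      Nat.card (SpOrthogonal.Sp m F ⧸ SpOrthogonal.orthogonalSubgroup Rp.1) := by
      exact_mod_cast hlt
    have r₁ := congrArg Complex.re e₁
    have r₂ := congrArg Complex.re e₂
    simp only [Pi.add_apply, Complex.add_re, Complex.natCast_re] at r₁ r₂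
    linarith
  · have hhalf := SpOrthogonal.isHalf_of_isConjRepresentatives hS
    have himage := SpOrthogonal.image_filter_eq hS
    set T := Finset.univ.filter fun η : Fˣ →* ℂˣ ↦ η.comp (SpOrthogonal.eigenvalue v hv) ∈ S
    have hinj : Set.InjOn (fun η : Fˣ →* ℂˣ ↦ η.comp (SpOrthogonal.eigenvalue v hv)) T :=
      fun _ _ _ _ h ↦ SpOrthogonal.comp_eigenvalue_injective h
    have hne {η : Fˣ →* ℂˣ} (hη : η ∈ T) : η ≠ 1 := fun h ↦ hhalf.one_notMem (h ▸ hη)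
    have hsum : ∑ ζ ∈ S, (SpOrthogonal.inducedRep ζ).character =
        ∑ η ∈ T, SpOrthogonal.theta m η := by
      rw [← himage, Finset.sum_image hinj]
      exact Finset.sum_congr rfl fun η _ ↦ SpOrthogonal.character_inducedRep η v hv
    refine ⟨?_, fun ζ hζ ↦ ?_, fun ζ hζ ξ hξ h ↦ ?_, ?_, ?_⟩
    -- The group of characters has order q − 1 = 1 + 2|S|, so q/2 = |S| + 1.
    · have h := hhalf.card_eq
      rw [SpOrthogonal.card_characters] at h
      rw [← himage, Finset.card_image_of_injOn hinj, Fintype.card_eq_card_units_add_one, h]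
      omega
    · rw [← himage] at hζ
      obtain ⟨η, hη, rfl⟩ := Finset.mem_image.1 hζ
      exact SpOrthogonal.inducedRep_isIrreducible hm2 (hne hη) v hv
    · rw [← himage] at hζ hξ
      obtain ⟨η, hη, rfl⟩ := Finset.mem_image.1 hζ
      obtain ⟨κ, hκ, rfl⟩ := Finset.mem_image.1 hξ
      simp only [SpOrthogonal.character_inducedRep] at h
      rcases (SpOrthogonal.theta_eq_iff hm2 (hne hη) (hne hκ)).1 h with rfl | h
      · rfl
      · have hinv : η⁻¹ = κ := by
          rw [← mul_one η⁻¹, ← h]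
          ext; simp
        exact absurd (hinv ▸ hκ) ((hhalf.mem_iff η (hne hη)).1 hη)
    · rw [hsum]
      exact (hdec T hhalf).1
    · rw [hsum]
      exact (hdec T hhalf).2
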